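/- **Model.** An algorithm in the asymmetric streaming model is a program of a deterministic random access machine working on two strings $\bar s, s$ of the same length $n\ge 1$ over a finite alphabet $\Sigma$, with characters given as the numbers $0,\dots,|\Sigma|-1$. The offline string $\bar s$ can be queried at any position at any time; the online string $s$ is received once, character by character, in order. The algorithm is told $n$ and the accuracy parameter $\epsilon$, the latter as the integer $\lceil 1/\epsilon\rceil$. Its memory is the maximal number of bits, over the whole run, occupied by its nonzero registers (bit length of the register's number plus bit length of its contents) together with the temporary values of expressions being evaluated; $n$, $\lceil 1/\epsilon\rceil$ and $\bar s$ are read-only and are not counted until they are copied or used in a computation. Write $\mathrm{lcs}(\bar s,s)$ for the length of a longest common (not necessarily contiguous) subsequence. An algorithm finds an $\alpha$-approximation ($0\le\alpha\le 1$) of the LCS if on every input it terminates with a number $v$ such that $\alpha\cdot\mathrm{lcs}(\bar s,s)\le v\le \mathrm{lcs}(\bar s,s)$. Memory $\tilde O(f(n,\epsilon))$ means: there are constants $C$ and $c$, independent of $n$, $\epsilon$, $\Sigma$ and the strings, such that at most $C\cdot f(n,\epsilon)\cdot(1+\log n)^c\cdot(1+\log|\Sigma|)$ bits are used (for $|\Sigma|\le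 n^{O(1)}$ this hides only a power of $\log n$). **Theorem.** 1. There is a single-pass deterministic asymmetric streaming algorithm that, for all $n\ge 1$, all $0<\epsilon^*<1$ and all strings $\bar s,s$ of length $n$, finds a $(1-\epsilon^*)^{\sqrt n}$-approximation of the LCS of $\bar s$ and $s$ using $\tilde O(\sqrt n+\log_{1+\epsilon^*}n)$ memory. 2. There is a single-pass deterministic asymmetric streaming algorithm that, for all $n\ge 1$, all $0<\epsilon<1$ and all strings $\bar s,s$ of length $n$, finds a $(1-\epsilon)$-approximation of the LCS of $\bar s$ and $s$ using $\tilde O(\sqrt n/\epsilon)$ memory. In each part one and the same program works for all $n$, all alphabets and all values of the parameter. -/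

import Mathlib

/-- Length of a longest common subsequence of two strings: the largest length of a string that is
a (not necessarily contiguous) subsequence of both. -/
noncomputable def lcsLength {α : Type*} (a b : List α) : ℕ :=
  sSup {k | ∃ t : List α, t.Sublist a ∧ t.Sublist b ∧ t.length = k}

/-- The supremum in `lcsLength` is a maximum. -/
theorem lcsLength_isGreatest {α : Type*} (a b : List α) :
    IsGreatest {k | ∃ t : List α, t.Sublist a ∧ t.Sublist b ∧ t.length = k} (lcsLength a b) := by
  have hbdd : BddAbove {k | ∃ t : List α, t.Sublist a ∧ t.Sublist b ∧ t.length = k} :=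
    ⟨a.length, by rintro k ⟨t, ha, _, rfl⟩; exact ha.length_le⟩
  exact ⟨Nat.sSup_mem ⟨0, [], List.nil_sublist _, List.nil_sublist _, rfl⟩ hbdd,
    fun k hk => le_csSup hbdd hk⟩

/-! ### The asymmetric streaming machine

A random access machine whose working memory is a sequence of registers holding natural numbers.
It has read-only random access to the offline string, and it receives the characters of the online
string one at a time: a character that has been received cannot be received again. Characters are
represented by natural numbers. Memory is measured in bits. -/

namespace AsymStream

/-- The read-only data of a run: the common length of the strings, the accuracy parameter and the
oracle for the characters of the offline string (positions are counted from `0`). -/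
structure Input where
  len : ℕ
  accuracy : ℕ
  offline : ℕ → ℕ

/-- Contents of the working memory; all but finitely many registers hold `0`. -/
abbrev Memory := ℕ →₀ ℕ

/-- Expressions over the working memory and the read-only data. -/
inductive Expr where
  | const (k : ℕ)
  | len
  | accuracy
  | load (address : Expr)
  | query (position : Expr)
  | add (e₁ e₂ : Expr)
  | sub (e₁ e₂ : Expr)
  | mul (e₁ e₂ : Expr)
  | div (e₁ e₂ : Expr)
  | lt (e₁ e₂ : Expr)
  | eq (e₁ e₂ : Expr)

/-- The value of an expression. Subtraction is truncated at `0`, division is rounded down, and a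
comparison has value `1` or `0`. -/
def Expr.eval (I : Input) (M : Memory) : Expr → ℕ
  | .const k => k
  | .len => I.len
  | .accuracy => I.accuracy
  | .load e => M (e.eval I M)
  | .query e => I.offline (e.eval I M)
  | .add e₁ e₂ => e₁.eval I M + e₂.eval I M
  | .sub e₁ e₂ => e₁.eval I M - e₂.eval I M
  | .mul e₁ e₂ => e₁.eval I M * e₂.eval I M
  | .div e₁ e₂ => e₁.eval I M / e₂.eval I M
  | .lt e₁ e₂ => if e₁.eval I M < e₂.eval I M then 1 else 0
  | .eq e₁ e₂ => if e₁.eval I M = e₂.eval I M then 1 else 0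

/-- The scratch memory (in bits) charged for evaluating an expression: the total bit length of the
values of all of its subexpressions. -/
def Expr.scratch (I : Input) (M : Memory) : Expr → ℕ
  | .const k => Nat.size k
  | .len => Nat.size I.len
  | .accuracy => Nat.size I.accuracy
  | .load e => e.scratch I M + Nat.size ((Expr.load e).eval I M)
  | .query e => e.scratch I M + Nat.size ((Expr.query e).eval I M)
  | .add e₁ e₂ => e₁.scratch I M + e₂.scratch I M + Nat.size ((Expr.add e₁ e₂).eval I M)
  | .sub e₁ e₂ => e₁.scratch I M + e₂.scratch I M + Nat.size ((Expr.sub e₁ e₂).eval I M)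
  | .mul e₁ e₂ => e₁.scratch I M + e₂.scratch I M + Nat.size ((Expr.mul e₁ e₂).eval I M)
  | .div e₁ e₂ => e₁.scratch I M + e₂.scratch I M + Nat.size ((Expr.div e₁ e₂).eval I M)
  | .lt e₁ e₂ => e₁.scratch I M + e₂.scratch I M + Nat.size ((Expr.lt e₁ e₂).eval I M)
  | .eq e₁ e₂ => e₁.scratch I M + e₂.scratch I M + Nat.size ((Expr.eq e₁ e₂).eval I M)

/-- Programs. `receive a` removes the next character of the online string from the stream and
writes it to the register whose number is the value of `a`. -/
inductive Program where
  | skip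
  | store (address value : Expr)
  | receive (address : Expr)
  | seq (p₁ p₂ : Program)
  | ite (cond : Expr) (p₁ p₂ : Program)
  | loop (cond : Expr) (body : Program)

/-- The space, in bits, that is occupied by the working memory: every register that does not hold
`0` costs the bit length of its number plus the bit length of its contents. -/
def space (M : Memory) : ℕ := M.sum fun address value => Nat.size address + Nat.size value

/-- A state of a run: the working memory and the part of the online string still to arrive. -/
structure State where
  mem : Memory
  stream : List ℕ

/-- `Runs I B p S S'`: started in the state `S`, the program `p` terminates in the state `S'`, and
at no time does it use more than `B` bits of working memory, scratch memory included. -/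
inductive Runs (I : Input) (B : ℕ) : Program → State → State → Prop
  | skip (S : State) : Runs I B .skip S S
  | store (a e : Expr) (S : State)
      (hscratch : space S.mem + a.scratch I S.mem + e.scratch I S.mem ≤ B)
      (hspace : space (S.mem.update (a.eval I S.mem) (e.eval I S.mem)) ≤ B) :
      Runs I B (.store a e) S ⟨S.mem.update (a.eval I S.mem) (e.eval I S.mem), S.stream⟩
  | receive (a : Expr) (M : Memory) (x : ℕ) (rest : List ℕ)
      (hscratch : space M + a.scratch I M + Nat.size x ≤ B)
      (hspace : space (M.update (a.eval I M) x) ≤ B) :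
      Runs I B (.receive a) ⟨M, x :: rest⟩ ⟨M.update (a.eval I M) x, rest⟩
  | seq (p₁ p₂ : Program) (S S' S'' : State) (h₁ : Runs I B p₁ S S') (h₂ : Runs I B p₂ S' S'') :
      Runs I B (.seq p₁ p₂) S S''
  | ite_true (b : Expr) (p₁ p₂ : Program) (S S' : State)
      (hscratch : space S.mem + b.scratch I S.mem ≤ B)
      (hb : b.eval I S.mem ≠ 0) (h : Runs I B p₁ S S') : Runs I B (.ite b p₁ p₂) S S'
  | ite_false (b : Expr) (p₁ p₂ : Program) (S S' : State)
      (hscratch : space S.mem + b.scratch I S.mem ≤ B)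
      (hb : b.eval I S.mem = 0) (h : Runs I B p₂ S S') : Runs I B (.ite b p₁ p₂) S S'
  | loop_true (b : Expr) (p : Program) (S S' S'' : State)
      (hscratch : space S.mem + b.scratch I S.mem ≤ B)
      (hb : b.eval I S.mem ≠ 0) (h : Runs I B p S S') (hloop : Runs I B (.loop b p) S' S'') :
      Runs I B (.loop b p) S S''
  | loop_false (b : Expr) (p : Program) (S : State)
      (hscratch : space S.mem + b.scratch I S.mem ≤ B)
      (hb : b.eval I S.mem = 0) : Runs I B (.loop b p) S S

/-- The machine is deterministic: the final state depends only on the program, the read-only data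
and the initial state. -/
theorem Runs.deterministic {I : Input} {B B' : ℕ} {p : Program} {S S₁ S₂ : State}
    (h₁ : Runs I B p S S₁) (h₂ : Runs I B' p S S₂) : S₁ = S₂ := by
  induction h₁ generalizing S₂ with
  | skip S => cases h₂; rfl
  | store a e S _ _ => cases h₂; rfl
  | receive a M x rest _ _ => cases h₂; rfl
  | seq p₁ p₂ S S' S'' _ _ ih₁ ih₂ =>
    cases h₂ with
    | seq _ _ _ T _ k₁ k₂ => obtain rfl := ih₁ k₁; exact ih₂ k₂
  | ite_true b p₁ p₂ S S' _ hb _ ih =>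
    cases h₂ with
    | ite_true _ _ _ _ _ _ _ k => exact ih k
    | ite_false _ _ _ _ _ _ kb k => exact absurd kb hb
  | ite_false b p₁ p₂ S S' _ hb _ ih =>
    cases h₂ with
    | ite_true _ _ _ _ _ _ kb k => exact absurd hb kb
    | ite_false _ _ _ _ _ _ _ k => exact ih k
  | loop_true b p S S' S'' _ hb _ _ ih₁ ih₂ =>
    cases h₂ with
    | loop_true _ _ _ T _ _ _ k₁ k₂ => obtain rfl := ih₁ k₁; exact ih₂ k₂
    | loop_false _ _ _ _ kb => exact absurd kb hb
  | loop_false b p S _ hb =>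
    cases h₂ with
    | loop_true _ _ _ _ _ _ kb _ _ => exact absurd hb kb
    | loop_false _ _ _ _ _ => rfl

/-- The read-only data for the offline string `t` and the accuracy `ε`. The algorithm is told the
length of the strings, and it is told `ε` in the form of the integer `⌈1/ε⌉`. -/
noncomputable def input {n σ : ℕ} (t : Fin n → Fin σ) (ε : ℝ) : Input where
  len := n
  accuracy := ⌈1 / ε⌉₊
  offline i := if h : i < n then (t ⟨i, h⟩ : ℕ) else 0

/-- The state before the first character of the online string `s` has arrived: the working memory
is blank. -/
def start {n σ : ℕ} (s : Fin n → Fin σ) : State where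
  mem := 0
  stream := List.ofFn fun i => (s i : ℕ)

/-- With offline string `t`, accuracy `ε` and online string `s`, the program `P` terminates with the
number `v` in register `0`, after a single pass over `s`, and never uses more than `B` bits. -/
def Outputs (P : Program) {n σ : ℕ} (t : Fin n → Fin σ) (ε : ℝ) (s : Fin n → Fin σ)
    (B v : ℕ) : Prop :=
  ∃ S : State, Runs (input t ε) B P (start s) S ∧ S.mem 0 = v

/-- `P` is a single-pass deterministic asymmetric streaming algorithm that approximates the length
of the longest common subsequence of two strings of length `n` within the factor `ratio n ε` and
uses `Õ(bound n ε)` bits of memory, where `Õ` hides a constant factor, a power of the logarithm of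
`n` and the number of bits of a character. The program, the constant and the power depend neither on
`n`, on the alphabet nor on `ε`. -/
def ApproximatesLCS (P : Program) (ratio bound : ℕ → ℝ → ℝ) : Prop :=
  ∃ (C : ℝ) (c : ℕ), ∀ (n σ : ℕ) (ε : ℝ), 1 ≤ n → 0 < ε → ε < 1 →
    ∀ t s : Fin n → Fin σ, ∃ B v : ℕ,
      Outputs P t ε s B v ∧
      (B : ℝ) ≤ C * bound n ε * (1 + Real.log n) ^ c * (1 + Real.log σ) ∧
      ratio n ε * (lcsLength (List.ofFn t) (List.ofFn s) : ℝ) ≤ (v : ℝ) ∧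
      v ≤ lcsLength (List.ofFn t) (List.ofFn s)

end AsymStream

/-! The online string is cut into at most `Nat.sqrt n` blocks of length about `√n`. After a prefix
of length `r` has been read, the exact dynamic program would remember, for every `p`, the LCS length
of the first `p` offline characters with that prefix. This function of `p` is monotone, so it is
determined by the first positions at which it reaches each value. The algorithm keeps such positions
only for a sparse sequence of thresholds growing by a factor of about `1 + 1/A`, which replaces the
function by an approximation `threshold A (u p)` from below.

To process a block, its characters are stored and the offline string is swept once. The row of the
alignment table for the current `p` is held in one array of block length, and its first entry is
read off the stored positions. The last column is rounded down to thresholds, and the first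
positions of the levels reached become the data for the next block. Inside a block nothing is lost:
the recurrence consists of maxima and `+1`, and it preserves an error factor `≥ 1` in the first
column (`prefixLcs_le_mul_alignTable`). Only the rounding costs a factor `c`, once per block
(`exec_processBlock`), so the total loss is at most `c ^ Nat.sqrt n` (`exec_blocks`), where `(1 -
1/D) * c ≤ 1` (`exists_growth_factor`).

The memory consists of `O(√n)` cells for the block and the row and `O(D log n)` cells for the
thresholds (`level_le_log`), each of `O(log n + log σ)` bits, plus scratch space. Part 1 takes `D =
⌈1/ε⌉`. Part 2 takes `D = ⌈1/ε⌉ * Nat.sqrt n` and uses Bernoulli's inequality.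

The machine is handled by letting memories represent records of variables (`Rep`) and proving `Exec`
statements that combine the final values with the memory budget. -/

namespace AsymStream

/-! ### Memory bounds for expressions -/

/-- Number of nodes of an expression. -/
def Expr.nodes : Expr → ℕ
  | .const _ => 1
  | .len => 1
  | .accuracy => 1
  | .load e => e.nodes + 1
  | .query e => e.nodes + 1
  | .add e₁ e₂ => e₁.nodes + e₂.nodes + 1
  | .sub e₁ e₂ => e₁.nodes + e₂.nodes + 1
  | .mul e₁ e₂ => e₁.nodes + e₂.nodes + 1
  | .div e₁ e₂ => e₁.nodes + e₂.nodes + 1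
  | .lt e₁ e₂ => e₁.nodes + e₂.nodes + 1
  | .eq e₁ e₂ => e₁.nodes + e₂.nodes + 1

/-- All constants of the expression are less than `32`. -/
def Expr.smallConsts : Expr → Bool
  | .const k => k < 32
  | .len => true
  | .accuracy => true
  | .load e => e.smallConsts
  | .query e => e.smallConsts
  | .add e₁ e₂ => e₁.smallConsts && e₂.smallConsts
  | .sub e₁ e₂ => e₁.smallConsts && e₂.smallConsts
  | .mul e₁ e₂ => e₁.smallConsts && e₂.smallConsts
  | .div e₁ e₂ => e₁.smallConsts && e₂.smallConsts
  | .lt e₁ e₂ => e₁.smallConsts && e₂.smallConsts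
  | .eq e₁ e₂ => e₁.smallConsts && e₂.smallConsts

/-- The expression does not mention the accuracy parameter. -/
def Expr.accuracyFree : Expr → Bool
  | .const _ => true
  | .len => true
  | .accuracy => false
  | .load e => e.accuracyFree
  | .query e => e.accuracyFree
  | .add e₁ e₂ => e₁.accuracyFree && e₂.accuracyFree
  | .sub e₁ e₂ => e₁.accuracyFree && e₂.accuracyFree
  | .mul e₁ e₂ => e₁.accuracyFree && e₂.accuracyFree
  | .div e₁ e₂ => e₁.accuracyFree && e₂.accuracyFree
  | .lt e₁ e₂ => e₁.accuracyFree && e₂.accuracyFree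
  | .eq e₁ e₂ => e₁.accuracyFree && e₂.accuracyFree

theorem Expr.one_le_nodes (e : Expr) : 1 ≤ e.nodes := by
  cases e <;> simp [Expr.nodes]

section Scratch

variable {I : Input} {M : Memory} {w : ℕ}

/-- Every node adds at most `w` bits: a product adds the exponents of its factors, a sum needs one
bit more than its larger term, and loads and queries are bounded by `w` bits whatever the address
is. -/
theorem Expr.eval_lt_two_pow (hw : 5 ≤ w) (hM : ∀ r, M r < 2 ^ w) (hlen : I.len < 2 ^ w)
    (hoff : ∀ i, I.offline i < 2 ^ w) (e : Expr) (hc : e.smallConsts = true)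
    (ha : e.accuracyFree = true ∨ I.accuracy < 2 ^ w) : e.eval I M < 2 ^ (w * e.nodes) := by
  have h32 : 32 ≤ 2 ^ w := by
    calc 32 = 2 ^ 5 := by norm_num
      _ ≤ 2 ^ w := Nat.pow_le_pow_right (by norm_num) hw
  have hmono : ∀ {m n : ℕ}, m ≤ n → 2 ^ (w * m) ≤ 2 ^ (w * n) := fun h =>
    Nat.pow_le_pow_right (by norm_num) (Nat.mul_le_mul_left w h)
  have hone : ∀ e : Expr, 2 ^ w ≤ 2 ^ (w * e.nodes) := fun e => by
    simpa using hmono e.one_le_nodes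
  have hle : ∀ {x y m n : ℕ}, x < 2 ^ (w * m) → y < 2 ^ (w * n) →
      x + y < 2 ^ (w * (m + n + 1)) := fun {x y m n} hx hy => by
    have h₁ : 2 ^ (w * m) ≤ 2 ^ (w * (m + n)) := hmono (by omega)
    have h₂ : 2 ^ (w * n) ≤ 2 ^ (w * (m + n)) := hmono (by omega)
    have h₃ : 2 ^ (w * (m + n + 1)) = 2 ^ (w * (m + n)) * 2 ^ w := by rw [← pow_add]; ring_nf
    nlinarith
  induction e with
  | const k =>
    simp only [Expr.smallConsts, decide_eq_true_eq] at hc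
    simpa [Expr.eval, Expr.nodes] using hc.trans_le h32
  | len => simpa [Expr.eval, Expr.nodes] using hlen
  | accuracy => simpa [Expr.eval, Expr.nodes, Expr.accuracyFree] using ha
  | load e ih => exact (hM _).trans_le (hone _)
  | query e ih => exact (hoff _).trans_le (hone _)
  | add e₁ e₂ ih₁ ih₂ =>
    simp only [Expr.smallConsts, Expr.accuracyFree, Bool.and_eq_true] at hc ha
    exact hle (ih₁ hc.1 (ha.imp_left And.left)) (ih₂ hc.2 (ha.imp_left And.right))
  | sub e₁ e₂ ih₁ ih₂ =>
    simp only [Expr.smallConsts, Expr.accuracyFree, Bool.and_eq_true] at hc ha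
    exact (Nat.sub_le _ _).trans_lt ((ih₁ hc.1 (ha.imp_left And.left)).trans_le
      (hmono (by simp only [Expr.nodes]; omega)))
  | mul e₁ e₂ ih₁ ih₂ =>
    simp only [Expr.smallConsts, Expr.accuracyFree, Bool.and_eq_true] at hc ha
    calc e₁.eval I M * e₂.eval I M < 2 ^ (w * e₁.nodes) * 2 ^ (w * e₂.nodes) :=
          Nat.mul_lt_mul'' (ih₁ hc.1 (ha.imp_left And.left)) (ih₂ hc.2 (ha.imp_left And.right))
      _ = 2 ^ (w * (e₁.nodes + e₂.nodes)) := by rw [← pow_add, mul_add]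
      _ ≤ _ := hmono (by simp only [Expr.nodes]; omega)
  | div e₁ e₂ ih₁ ih₂ =>
    simp only [Expr.smallConsts, Expr.accuracyFree, Bool.and_eq_true] at hc ha
    exact (Nat.div_le_self _ _).trans_lt ((ih₁ hc.1 (ha.imp_left And.left)).trans_le
      (hmono (by simp only [Expr.nodes]; omega)))
  | lt e₁ e₂ =>
    refine lt_of_lt_of_le ?_ (hone _)
    simp only [Expr.eval]; split_ifs <;> omega
  | eq e₁ e₂ =>
    refine lt_of_lt_of_le ?_ (hone _)
    simp only [Expr.eval]; split_ifs <;> omega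

/-- Each of the subexpressions has a value of at most `w * e.nodes` bits, and there are `e.nodes` of
them. -/
theorem Expr.scratch_le (hw : 5 ≤ w) (hM : ∀ r, M r < 2 ^ w) (hlen : I.len < 2 ^ w)
    (hoff : ∀ i, I.offline i < 2 ^ w) (e : Expr) (hc : e.smallConsts = true)
    (ha : e.accuracyFree = true ∨ I.accuracy < 2 ^ w) :
    e.scratch I M ≤ e.nodes ^ 2 * w := by
  have hsize : ∀ e : Expr, e.smallConsts = true → (e.accuracyFree = true ∨ I.accuracy < 2 ^ w) →
      Nat.size (e.eval I M) ≤ w * e.nodes := fun e hc ha =>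
    Nat.size_le.2 (e.eval_lt_two_pow hw hM hlen hoff hc ha)
  have hself := hsize e hc ha
  induction e with
  | const k => simpa [Expr.scratch, Expr.nodes, Expr.eval] using hself
  | len => simpa [Expr.scratch, Expr.nodes, Expr.eval] using hself
  | accuracy => simpa [Expr.scratch, Expr.nodes, Expr.eval] using hself
  | load e ih =>
    have := ih hc ha (hsize e hc ha)
    simp only [Expr.scratch, Expr.nodes] at hself ⊢
    nlinarith
  | query e ih =>
    have := ih hc ha (hsize e hc ha)
    simp only [Expr.scratch, Expr.nodes] at hself ⊢
    nlinarith
  | add e₁ e₂ ih₁ ih₂ | sub e₁ e₂ ih₁ ih₂ | mul e₁ e₂ ih₁ ih₂ | div e₁ e₂ ih₁ ih₂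
  | lt e₁ e₂ ih₁ ih₂ | eq e₁ e₂ ih₁ ih₂ =>
    simp only [Expr.smallConsts, Expr.accuracyFree, Bool.and_eq_true] at hc ha
    have h₁ := ih₁ hc.1 (ha.imp_left And.left) (hsize _ hc.1 (ha.imp_left And.left))
    have h₂ := ih₂ hc.2 (ha.imp_left And.right) (hsize _ hc.2 (ha.imp_left And.right))
    simp only [Expr.scratch, Expr.nodes] at hself ⊢
    have : (e₁.nodes + e₂.nodes + 1) ^ 2 * w =
      e₁.nodes ^ 2 * w + e₂.nodes ^ 2 * w + w * (e₁.nodes + e₂.nodes + 1) +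
        (2 * e₁.nodes * e₂.nodes + e₁.nodes + e₂.nodes) * w := by ring
    omega

end Scratch

theorem space_le {M : Memory} {R w : ℕ} (hM : ∀ r, M r < 2 ^ w) (hR : ∀ r, M r ≠ 0 → r < R) :
    space M ≤ R * (Nat.size R + w) := by
  have hsub : M.support ⊆ Finset.range R := fun r hr => by
    simpa using hR r (by simpa using hr)
  calc space M ≤ ∑ _r ∈ M.support, (Nat.size R + w) :=
        Finset.sum_le_sum fun r hr => add_le_add
          (Nat.size_le_size (hR r (by simpa using hr)).le) (Nat.size_le.2 (hM r))
    _ = M.support.card * (Nat.size R + w) := by simp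
    _ ≤ R * (Nat.size R + w) := Nat.mul_le_mul_right _ (by simpa using Finset.card_le_card hsub)

/-! ### Abstract states

The scalar variable with number `a` lives in the register `a`, and the entry with index `k` of the
array variable with number `a` lives in the register `a + 16 * k`. -/

/-- The values of the variables of the algorithm. -/
structure Vars where
  tg : ℕ := 0
  q : ℕ := 0
  e : ℕ := 0
  A : ℕ := 0
  r : ℕ := 0
  m : ℕ := 0
  p : ℕ := 0
  i : ℕ := 0
  tf : ℕ := 0
  k : ℕ := 0
  d : ℕ := 0
  j : ℕ := 0
  b : ℕ → ℕ := fun _ => 0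
  L : ℕ → ℕ := fun _ => 0
  P : ℕ → ℕ := fun _ => 0
  Q : ℕ → ℕ := fun _ => 0

/-- The memory `M` holds the values `σ`; array indices are less than `N`, and all contents have at
most `w` bits. -/
structure Rep (N w : ℕ) (σ : Vars) (M : Memory) : Prop where
  bits : ∀ r, M r < 2 ^ w
  addr : ∀ r, M r ≠ 0 → r < 16 * N
  tg : M 0 = σ.tg
  q : M 1 = σ.q
  e : M 2 = σ.e
  A : M 3 = σ.A
  r : M 4 = σ.r
  m : M 5 = σ.m
  p : M 6 = σ.p
  i : M 7 = σ.i
  tf : M 8 = σ.tf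
  k : M 9 = σ.k
  d : M 10 = σ.d
  j : M 11 = σ.j
  b : ∀ k, M (12 + 16 * k) = σ.b k
  L : ∀ k, M (13 + 16 * k) = σ.L k
  P : ∀ k, M (14 + 16 * k) = σ.P k
  Q : ∀ k, M (15 + 16 * k) = σ.Q k

namespace Rep

variable {N w v k : ℕ} {σ : Vars} {M : Memory}

theorem update_bits (h : Rep N w σ M) (hv : v < 2 ^ w) (a : ℕ) :
    ∀ r, M.update a v r < 2 ^ w := fun r => by
  rw [Finsupp.coe_update, Function.update_apply]
  split_ifs
  exacts [hv, h.bits r]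

theorem update_addr (h : Rep N w σ M) {a : ℕ} (ha : a < 16 * N) :
    ∀ r, M.update a v r ≠ 0 → r < 16 * N := fun r => by
  rw [Finsupp.coe_update, Function.update_apply]
  split_ifs with hr
  exacts [fun _ => hr ▸ ha, h.addr r]

/-- Storing a value in a register within the address range. -/
theorem update (h : Rep N w σ M) {σ' : Vars} {a : ℕ} (ha : a < 16 * N) (hv : v < 2 ^ w)
    (hs : (if 0 = a then v else σ.tg) = σ'.tg ∧ (if 1 = a then v else σ.q) = σ'.q ∧
      (if 2 = a then v else σ.e) = σ'.e ∧ (if 3 = a then v else σ.A) = σ'.A ∧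
      (if 4 = a then v else σ.r) = σ'.r ∧ (if 5 = a then v else σ.m) = σ'.m ∧
      (if 6 = a then v else σ.p) = σ'.p ∧ (if 7 = a then v else σ.i) = σ'.i ∧
      (if 8 = a then v else σ.tf) = σ'.tf ∧ (if 9 = a then v else σ.k) = σ'.k ∧
      (if 10 = a then v else σ.d) = σ'.d ∧ (if 11 = a then v else σ.j) = σ'.j)
    (hb : ∀ k, (if 12 + 16 * k = a then v else σ.b k) = σ'.b k)
    (hL : ∀ k, (if 13 + 16 * k = a then v else σ.L k) = σ'.L k)
    (hP : ∀ k, (if 14 + 16 * k = a then v else σ.P k) = σ'.P k)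
    (hQ : ∀ k, (if 15 + 16 * k = a then v else σ.Q k) = σ'.Q k) :
    Rep N w σ' (M.update a v) := by
  obtain ⟨s0, s1, s2, s3, s4, s5, s6, s7, s8, s9, s10, s11⟩ := hs
  refine ⟨h.update_bits hv _, h.update_addr ha, ?_, ?_, ?_, ?_, ?_, ?_, ?_, ?_, ?_, ?_, ?_, ?_,
    fun x => ?_, fun x => ?_, fun x => ?_, fun x => ?_⟩ <;>
    rw [Finsupp.coe_update, Function.update_apply]
  exacts [h.tg ▸ s0, h.q ▸ s1, h.e ▸ s2, h.A ▸ s3, h.r ▸ s4, h.m ▸ s5, h.p ▸ s6, h.i ▸ s7,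
    h.tf ▸ s8, h.k ▸ s9, h.d ▸ s10, h.j ▸ s11, h.b x ▸ hb x, h.L x ▸ hL x, h.P x ▸ hP x,
    h.Q x ▸ hQ x]

theorem set_tg (h : Rep N w σ M) (hN : 0 < N) (hv : v < 2 ^ w) :
    Rep N w { σ with tg := v } (M.update 0 v) :=
  h.update (by omega) hv (by simp) (fun k => if_neg (by omega)) (fun k => if_neg (by omega))
    (fun k => if_neg (by omega)) (fun k => if_neg (by omega))

theorem set_q (h : Rep N w σ M) (hN : 0 < N) (hv : v < 2 ^ w) :
    Rep N w { σ with q := v } (M.update 1 v) :=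
  h.update (by omega) hv (by simp) (fun k => if_neg (by omega)) (fun k => if_neg (by omega))
    (fun k => if_neg (by omega)) (fun k => if_neg (by omega))

theorem set_e (h : Rep N w σ M) (hN : 0 < N) (hv : v < 2 ^ w) :
    Rep N w { σ with e := v } (M.update 2 v) :=
  h.update (by omega) hv (by simp) (fun k => if_neg (by omega)) (fun k => if_neg (by omega))
    (fun k => if_neg (by omega)) (fun k => if_neg (by omega))

theorem set_A (h : Rep N w σ M) (hN : 0 < N) (hv : v < 2 ^ w) :
    Rep N w { σ with A := v } (M.update 3 v) :=
  h.update (by omega) hv (by simp) (fun k => if_neg (by omega)) (fun k => if_neg (by omega))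
    (fun k => if_neg (by omega)) (fun k => if_neg (by omega))

theorem set_r (h : Rep N w σ M) (hN : 0 < N) (hv : v < 2 ^ w) :
    Rep N w { σ with r := v } (M.update 4 v) :=
  h.update (by omega) hv (by simp) (fun k => if_neg (by omega)) (fun k => if_neg (by omega))
    (fun k => if_neg (by omega)) (fun k => if_neg (by omega))

theorem set_m (h : Rep N w σ M) (hN : 0 < N) (hv : v < 2 ^ w) :
    Rep N w { σ with m := v } (M.update 5 v) :=
  h.update (by omega) hv (by simp) (fun k => if_neg (by omega)) (fun k => if_neg (by omega))
    (fun k => if_neg (by omega)) (fun k => if_neg (by omega))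

theorem set_p (h : Rep N w σ M) (hN : 0 < N) (hv : v < 2 ^ w) :
    Rep N w { σ with p := v } (M.update 6 v) :=
  h.update (by omega) hv (by simp) (fun k => if_neg (by omega)) (fun k => if_neg (by omega))
    (fun k => if_neg (by omega)) (fun k => if_neg (by omega))

theorem set_i (h : Rep N w σ M) (hN : 0 < N) (hv : v < 2 ^ w) :
    Rep N w { σ with i := v } (M.update 7 v) :=
  h.update (by omega) hv (by simp) (fun k => if_neg (by omega)) (fun k => if_neg (by omega))
    (fun k => if_neg (by omega)) (fun k => if_neg (by omega))

theorem set_tf (h : Rep N w σ M) (hN : 0 < N) (hv : v < 2 ^ w) :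
    Rep N w { σ with tf := v } (M.update 8 v) :=
  h.update (by omega) hv (by simp) (fun k => if_neg (by omega)) (fun k => if_neg (by omega))
    (fun k => if_neg (by omega)) (fun k => if_neg (by omega))

theorem set_k (h : Rep N w σ M) (hN : 0 < N) (hv : v < 2 ^ w) :
    Rep N w { σ with k := v } (M.update 9 v) :=
  h.update (by omega) hv (by simp) (fun k => if_neg (by omega)) (fun k => if_neg (by omega))
    (fun k => if_neg (by omega)) (fun k => if_neg (by omega))

theorem set_d (h : Rep N w σ M) (hN : 0 < N) (hv : v < 2 ^ w) :
    Rep N w { σ with d := v } (M.update 10 v) :=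
  h.update (by omega) hv (by simp) (fun k => if_neg (by omega)) (fun k => if_neg (by omega))
    (fun k => if_neg (by omega)) (fun k => if_neg (by omega))

theorem set_j (h : Rep N w σ M) (hN : 0 < N) (hv : v < 2 ^ w) :
    Rep N w { σ with j := v } (M.update 11 v) :=
  h.update (by omega) hv (by simp) (fun k => if_neg (by omega)) (fun k => if_neg (by omega))
    (fun k => if_neg (by omega)) (fun k => if_neg (by omega))

theorem set_b (h : Rep N w σ M) (hk : k < N) (hv : v < 2 ^ w) :
    Rep N w { σ with b := Function.update σ.b k v } (M.update (12 + 16 * k) v) :=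
  h.update (by omega) hv
    (by refine ⟨?_, ?_, ?_, ?_, ?_, ?_, ?_, ?_, ?_, ?_, ?_, ?_⟩ <;> exact if_neg (by omega))
    (fun x => by simp [Function.update_apply]) (fun x => if_neg (by omega))
    (fun x => if_neg (by omega)) (fun x => if_neg (by omega))

theorem set_L (h : Rep N w σ M) (hk : k < N) (hv : v < 2 ^ w) :
    Rep N w { σ with L := Function.update σ.L k v } (M.update (13 + 16 * k) v) :=
  h.update (by omega) hv
    (by refine ⟨?_, ?_, ?_, ?_, ?_, ?_, ?_, ?_, ?_, ?_, ?_, ?_⟩ <;> exact if_neg (by omega))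
    (fun x => if_neg (by omega)) (fun x => by simp [Function.update_apply])
    (fun x => if_neg (by omega)) (fun x => if_neg (by omega))

theorem set_P (h : Rep N w σ M) (hk : k < N) (hv : v < 2 ^ w) :
    Rep N w { σ with P := Function.update σ.P k v } (M.update (14 + 16 * k) v) :=
  h.update (by omega) hv
    (by refine ⟨?_, ?_, ?_, ?_, ?_, ?_, ?_, ?_, ?_, ?_, ?_, ?_⟩ <;> exact if_neg (by omega))
    (fun x => if_neg (by omega)) (fun x => if_neg (by omega))
    (fun x => by simp [Function.update_apply]) (fun x => if_neg (by omega))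

theorem set_Q (h : Rep N w σ M) (hk : k < N) (hv : v < 2 ^ w) :
    Rep N w { σ with Q := Function.update σ.Q k v } (M.update (15 + 16 * k) v) :=
  h.update (by omega) hv
    (by refine ⟨?_, ?_, ?_, ?_, ?_, ?_, ?_, ?_, ?_, ?_, ?_, ?_⟩ <;> exact if_neg (by omega))
    (fun x => if_neg (by omega)) (fun x => if_neg (by omega))
    (fun x => if_neg (by omega)) (fun x => by simp [Function.update_apply])

end Rep

/-! ### Execution on abstract states -/

/-- The memory budget: `16 * N` registers of `w` bits each and scratch memory for two expressions
with at most `100` nodes, at `W` bits per node. -/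
def budget (N w W : ℕ) : ℕ := 16 * N * (Nat.size (16 * N) + w) + 20000 * W

/-- The read-only data have at most `w` bits, the accuracy parameter excepted. -/
structure Ambient (I : Input) (N w W : ℕ) : Prop where
  pos : 0 < N
  five_le : 5 ≤ w
  len_lt : I.len < 2 ^ w
  offline_lt : ∀ i, I.offline i < 2 ^ w
  le : w ≤ W

/-- Started in a memory that holds `σ`, the program terminates within the budget in a memory that
holds `σ'`. -/
def Exec (I : Input) (N w W : ℕ) (p : Program) (σ : Vars) (l : List ℕ) (σ' : Vars)
    (l' : List ℕ) : Prop :=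
  ∀ M, Rep N w σ M → ∃ M', Rep N w σ' M' ∧ Runs I (budget N w W) p ⟨M, l⟩ ⟨M', l'⟩

/-- In every memory that holds `σ`, the value of the expression is `v`. -/
def Evals (I : Input) (N w : ℕ) (e : Expr) (σ : Vars) (v : ℕ) : Prop :=
  ∀ M, Rep N w σ M → e.eval I M = v

/-- The expression can be evaluated within half of the scratch budget. -/
def Fits (I : Input) (w W : ℕ) (e : Expr) : Prop :=
  ∀ M : Memory, (∀ r, M r < 2 ^ w) → e.scratch I M ≤ 10000 * W

/-- The expression has small constants and at most `100` nodes. -/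
def Expr.tame (e : Expr) : Bool := e.smallConsts && decide (e.nodes ≤ 100)

section

variable {I : Input} {N w W : ℕ}

/-- The accuracy parameter is not bounded in terms of `n`, so it need not fit in a word of `w` bits.
The few expressions that read it are charged at `W` bits per node; all others go through
`fits_of_accuracyFree`, which makes no assumption on it. -/
theorem fits_of_accuracy_lt (hI : Ambient I N w W) {e : Expr} (he : e.tame = true)
    (hacc : I.accuracy < 2 ^ W) : Fits I w W e := fun M hM => by
  have hpow : 2 ^ w ≤ 2 ^ W := Nat.pow_le_pow_right (by norm_num) hI.le
  simp only [Expr.tame, Bool.and_eq_true, decide_eq_true_eq] at he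
  calc e.scratch I M ≤ e.nodes ^ 2 * W :=
        e.scratch_le (hI.five_le.trans hI.le) (fun r => (hM r).trans_le hpow)
          (hI.len_lt.trans_le hpow) (fun i => (hI.offline_lt i).trans_le hpow) he.1 (Or.inr hacc)
    _ ≤ 100 ^ 2 * W := Nat.mul_le_mul_right _ (Nat.pow_le_pow_left he.2 2)

theorem fits_of_accuracyFree (hI : Ambient I N w W) {e : Expr}
    (he : (e.tame && e.accuracyFree) = true) : Fits I w W e := fun M hM => by
  simp only [Expr.tame, Bool.and_eq_true, decide_eq_true_eq] at he
  calc e.scratch I M ≤ e.nodes ^ 2 * w :=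
        e.scratch_le hI.five_le hM hI.len_lt hI.offline_lt he.1.1 (Or.inl he.2)
    _ ≤ 100 ^ 2 * W := Nat.mul_le_mul (Nat.pow_le_pow_left he.1.2 2) hI.le

theorem Rep.space_le {σ : Vars} {M : Memory} (h : Rep N w σ M) :
    space M ≤ 16 * N * (Nat.size (16 * N) + w) :=
  AsymStream.space_le h.bits h.addr

theorem Exec.seq {p₁ p₂ : Program} {σ σ' σ'' : Vars} {l l' l'' : List ℕ}
    (h₁ : Exec I N w W p₁ σ l σ' l') (h₂ : Exec I N w W p₂ σ' l' σ'' l'') :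
    Exec I N w W (.seq p₁ p₂) σ l σ'' l'' := fun M hM => by
  obtain ⟨M', hM', r₁⟩ := h₁ M hM
  obtain ⟨M'', hM'', r₂⟩ := h₂ M' hM'
  exact ⟨M'', hM'', .seq _ _ _ _ _ r₁ r₂⟩

theorem Exec.store {a e : Expr} {σ σ' : Vars} {l : List ℕ} {addr v : ℕ}
    (ha : Fits I w W a) (he : Fits I w W e) (hav : Evals I N w a σ addr)
    (hev : Evals I N w e σ v) (hrep : ∀ M, Rep N w σ M → Rep N w σ' (M.update addr v)) :
    Exec I N w W (.store a e) σ l σ' l := fun M hM => by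
  refine ⟨M.update addr v, hrep M hM, ?_⟩
  have h := Runs.store (I := I) (B := budget N w W) a e ⟨M, l⟩
    (by have := hM.space_le; have := ha M hM.bits; have := he M hM.bits
        simp only [budget]; omega)
    (by have := (hrep M hM).space_le
        simp only [hav M hM, hev M hM, budget]; omega)
  simpa only [hav M hM, hev M hM] using h

theorem Exec.of_eq {p : Program} {σ σ' τ : Vars} {l l' : List ℕ}
    (h : Exec I N w W p σ l σ' l') (hτ : σ' = τ) : Exec I N w W p σ l τ l' := hτ ▸ h

theorem Exec.receive {a : Expr} {σ σ' : Vars} {l : List ℕ} {addr x : ℕ} (hI : Ambient I N w W)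
    (ha : Fits I w W a) (hav : Evals I N w a σ addr) (hx : x < 2 ^ w)
    (hrep : ∀ M, Rep N w σ M → Rep N w σ' (M.update addr x)) :
    Exec I N w W (.receive a) σ (x :: l) σ' l := fun M hM => by
  refine ⟨M.update addr x, hrep M hM, ?_⟩
  have h := Runs.receive (I := I) (B := budget N w W) a M x l
    (by have := hM.space_le; have := ha M hM.bits; have := Nat.size_le.2 hx; have := hI.le
        simp only [budget]; omega)
    (by have := (hrep M hM).space_le
        simp only [hav M hM, budget]; omega)
  simpa only [hav M hM] using h

theorem Exec.ite_pos {c : Expr} {p₁ p₂ : Program} {σ σ' : Vars} {l l' : List ℕ}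
    (hc : Fits I w W c) (hcv : ∀ M, Rep N w σ M → c.eval I M ≠ 0)
    (h : Exec I N w W p₁ σ l σ' l') : Exec I N w W (.ite c p₁ p₂) σ l σ' l' := fun M hM => by
  obtain ⟨M', hM', r⟩ := h M hM
  refine ⟨M', hM', .ite_true _ _ _ _ _ ?_ (hcv M hM) r⟩
  have := hM.space_le; have := hc M hM.bits
  simp only [budget]; omega

theorem Exec.ite_neg {c : Expr} {p₁ p₂ : Program} {σ σ' : Vars} {l l' : List ℕ}
    (hc : Fits I w W c) (hcv : Evals I N w c σ 0)
    (h : Exec I N w W p₂ σ l σ' l') : Exec I N w W (.ite c p₁ p₂) σ l σ' l' := fun M hM => by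
  obtain ⟨M', hM', r⟩ := h M hM
  refine ⟨M', hM', .ite_false _ _ _ _ _ ?_ (hcv M hM) r⟩
  have := hM.space_le; have := hc M hM.bits
  simp only [budget]; omega

theorem Exec.loop_done {c : Expr} {p : Program} {σ : Vars} {l : List ℕ}
    (hc : Fits I w W c) (hcv : Evals I N w c σ 0) :
    Exec I N w W (.loop c p) σ l σ l := fun M hM => by
  refine ⟨M, hM, .loop_false _ _ _ ?_ (hcv M hM)⟩
  have := hM.space_le; have := hc M hM.bits
  simp only [budget]; omega

theorem Exec.loop_step {c : Expr} {p : Program} {σ σ' σ'' : Vars} {l l' l'' : List ℕ}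
    (hc : Fits I w W c) (hcv : ∀ M, Rep N w σ M → c.eval I M ≠ 0)
    (h : Exec I N w W p σ l σ' l') (hl : Exec I N w W (.loop c p) σ' l' σ'' l'') :
    Exec I N w W (.loop c p) σ l σ'' l'' := fun M hM => by
  obtain ⟨M', hM', r⟩ := h M hM
  obtain ⟨M'', hM'', r'⟩ := hl M' hM'
  refine ⟨M'', hM'', .loop_true _ _ _ _ _ ?_ (hcv M hM) r r'⟩
  have := hM.space_le; have := hc M hM.bits
  simp only [budget]; omega

/-- A loop that passes through the states `f 0, …, f T`. -/
theorem Exec.loop {c : Expr} {p : Program} {σ σ' : Vars} {l l' : List ℕ} (f : ℕ → Vars)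
    (g : ℕ → List ℕ) (T : ℕ) (h0 : f 0 = σ) (hT : f T = σ') (hg0 : g 0 = l) (hgT : g T = l')
    (hc : Fits I w W c) (hcv : ∀ x < T, ∀ M, Rep N w (f x) M → c.eval I M ≠ 0)
    (hdone : Evals I N w c (f T) 0)
    (h : ∀ x < T, Exec I N w W p (f x) (g x) (f (x + 1)) (g (x + 1))) :
    Exec I N w W (.loop c p) σ l σ' l' := by
  subst h0 hT hg0 hgT
  induction T generalizing f g with
  | zero => exact Exec.loop_done hc hdone
  | succ T ih =>
    refine Exec.loop_step hc (hcv 0 T.succ_pos) (h 0 T.succ_pos) ?_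
    exact ih (fun x => f (x + 1)) (fun x => g (x + 1)) (fun x hx => hcv _ (by omega)) hdone
      (fun x hx => h _ (by omega))

/-- A loop whose body preserves an invariant and decreases a measure. -/
theorem Exec.loop_of_invariant {c : Expr} {p : Program} (Inv : Vars → List ℕ → Prop)
    (Done : Vars → Prop) (μ : Vars → ℕ) (hc : Fits I w W c)
    (h : ∀ σ l, Inv σ l → (Done σ ∧ Evals I N w c σ 0) ∨ (∀ M, Rep N w σ M → c.eval I M ≠ 0) ∧
      ∃ σ' l', Inv σ' l' ∧ μ σ' < μ σ ∧ Exec I N w W p σ l σ' l')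
    (σ : Vars) (l : List ℕ) (hσ : Inv σ l) :
    ∃ σ' l', Inv σ' l' ∧ Done σ' ∧ Exec I N w W (.loop c p) σ l σ' l' := by
  induction hm : μ σ using Nat.strong_induction_on generalizing σ l with
  | _ m ih =>
    rcases h σ l hσ with ⟨hd, h0⟩ | ⟨hne, σ', l', hσ', hlt, hex⟩
    · exact ⟨σ, l, hσ, hd, Exec.loop_done hc h0⟩
    · obtain ⟨σ'', l'', hinv, hd, hloop⟩ := ih (μ σ') (hm ▸ hlt) σ' l' hσ' rfl
      exact ⟨σ'', l'', hinv, hd, Exec.loop_step hc hne hex hloop⟩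

end

end AsymStream

/-! ### Longest common subsequences and the alignment table -/

theorem lcsLength_mono {α : Type*} {a a' b b' : List α} (ha : a.Sublist a') (hb : b.Sublist b') :
    lcsLength a b ≤ lcsLength a' b' := by
  obtain ⟨t, h₁, h₂, h₃⟩ := (lcsLength_isGreatest a b).1
  exact (lcsLength_isGreatest a' b').2 ⟨t, h₁.trans ha, h₂.trans hb, h₃⟩

theorem lcsLength_nil_left {α : Type*} (b : List α) : lcsLength [] b = 0 := by
  obtain ⟨t, h₁, -, h₃⟩ := (lcsLength_isGreatest [] b).1
  simpa [List.sublist_nil.1 h₁] using h₃.symm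

theorem lcsLength_nil_right {α : Type*} (a : List α) : lcsLength a [] = 0 := by
  obtain ⟨t, -, h₂, h₃⟩ := (lcsLength_isGreatest a []).1
  simpa [List.sublist_nil.1 h₂] using h₃.symm

theorem sublist_concat_cases {α : Type*} {t a : List α} {x : α} (h : t.Sublist (a ++ [x])) :
    t.Sublist a ∨ ∃ u, t = u ++ [x] ∧ u.Sublist a := by
  obtain ⟨u, v, rfl, hu, hv⟩ := List.sublist_append_iff.1 h
  rcases List.sublist_singleton.1 hv with rfl | rfl
  · exact Or.inl (by simpa using hu)
  · exact Or.inr ⟨u, rfl, hu⟩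

/-- A common subsequence avoids the last `x`, or avoids the last `y`, or ends with both, which
forces `x = y`. -/
theorem lcsLength_concat {α : Type*} [DecidableEq α] (a b : List α) (x y : α) :
    lcsLength (a ++ [x]) (b ++ [y]) =
      max (max (lcsLength a (b ++ [y])) (lcsLength (a ++ [x]) b))
        (if x = y then lcsLength a b + 1 else 0) := by
  apply le_antisymm
  · obtain ⟨t, h₁, h₂, h₃⟩ := (lcsLength_isGreatest (a ++ [x]) (b ++ [y])).1
    rw [← h₃]
    rcases sublist_concat_cases h₁ with h₁' | ⟨u, rfl, hu⟩
    · exact le_max_of_le_left (le_max_of_le_left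
        ((lcsLength_isGreatest _ _).2 ⟨t, h₁', h₂, rfl⟩))
    rcases sublist_concat_cases h₂ with h₂' | ⟨v, huv, hv⟩
    · exact le_max_of_le_left (le_max_of_le_right
        ((lcsLength_isGreatest _ _).2 ⟨_, h₁, h₂', rfl⟩))
    obtain ⟨rfl, hxy⟩ := List.append_inj' huv rfl
    rw [if_pos (by simpa using hxy)]
    refine le_max_of_le_right ?_
    simpa using (lcsLength_isGreatest a b).2 ⟨u, hu, hv, rfl⟩
  · refine max_le (max_le (lcsLength_mono (List.sublist_append_left _ _) (List.Sublist.refl _))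
      (lcsLength_mono (List.Sublist.refl _) (List.sublist_append_left _ _))) ?_
    split_ifs with h
    · subst h
      obtain ⟨t, h₁, h₂, h₃⟩ := (lcsLength_isGreatest a b).1
      exact (lcsLength_isGreatest _ _).2 ⟨t ++ [x], h₁.append_right _, h₂.append_right _,
        by simp [h₃]⟩
    · exact Nat.zero_le _

namespace AsymStream

/-- The table of the dynamic program for aligning the string `a` with the string `b`, when the first
column is `f`. -/
def alignTable (a b f : ℕ → ℕ) : ℕ → ℕ → ℕ
  | 0, _ => 0
  | p + 1, 0 => f (p + 1)
  | p + 1, k + 1 => max (max (alignTable a b f p (k + 1)) (alignTable a b f (p + 1) k))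
      (if b k = a p then alignTable a b f p k + 1 else 0)

section Table

variable {a b f : ℕ → ℕ}

@[simp] theorem alignTable_zero (k : ℕ) : alignTable a b f 0 k = 0 := by rw [alignTable]

@[simp] theorem alignTable_succ_zero (p : ℕ) : alignTable a b f (p + 1) 0 = f (p + 1) := by
  rw [alignTable]

theorem alignTable_succ_succ (p k : ℕ) : alignTable a b f (p + 1) (k + 1) =
    max (max (alignTable a b f p (k + 1)) (alignTable a b f (p + 1) k))
      (if b k = a p then alignTable a b f p k + 1 else 0) := by rw [alignTable]

theorem alignTable_mono (hf : Monotone f) (k : ℕ) : Monotone fun p => alignTable a b f p k := by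
  refine monotone_nat_of_le_succ fun p => ?_
  cases k with
  | zero =>
    cases p with
    | zero => simp
    | succ p => simpa using hf (Nat.le_succ _)
  | succ k => rw [alignTable_succ_succ]; exact le_max_of_le_left (le_max_left _ _)

theorem alignTable_le (hf : ∀ p, f p ≤ p) (p k : ℕ) : alignTable a b f p k ≤ p := by
  induction p generalizing k with
  | zero => simp
  | succ p ihp =>
    induction k with
    | zero => simpa using hf _
    | succ k ihk =>
      rw [alignTable_succ_succ]
      have h₁ := ihp (k + 1)
      have h₂ := ihp k
      refine max_le (max_le (by omega) ihk) ?_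
      split_ifs <;> omega

/-- The first column enters the last column. -/
theorem le_alignTable (h0 : f 0 = 0) (p k : ℕ) : f p ≤ alignTable a b f p k := by
  cases p with
  | zero => simp [h0]
  | succ p =>
    induction k with
    | zero => simp
    | succ k ih => rw [alignTable_succ_succ]; exact le_max_of_le_left (le_max_of_le_right ih)

/-- Length of a longest common subsequence of the first `p` characters of `a` and the first `q`
characters of `s`. -/
def prefixLcs (a s : ℕ → ℕ) : ℕ → ℕ → ℕ := alignTable a s 0

theorem prefixLcs_zero_right (a s : ℕ → ℕ) (p : ℕ) : prefixLcs a s p 0 = 0 := by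
  cases p <;> simp [prefixLcs]

theorem prefixLcs_le (a s : ℕ → ℕ) (p q : ℕ) : prefixLcs a s p q ≤ p :=
  alignTable_le (fun _ => Nat.zero_le _) p q

/-- The exact table, restricted to the columns from `q` on, satisfies the same recurrence, and the
recurrence is monotone in the first column. -/
theorem alignTable_le_prefixLcs {s : ℕ → ℕ} {q : ℕ} (hf : ∀ p, f p ≤ prefixLcs a s p q)
    (p k : ℕ) : alignTable a (fun k => s (q + k)) f p k ≤ prefixLcs a s p (q + k) := by
  induction p generalizing k with
  | zero => simp
  | succ p ihp =>
    induction k with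
    | zero => simpa using hf _
    | succ k ihk =>
      rw [alignTable_succ_succ, ← add_assoc, prefixLcs, alignTable_succ_succ]
      refine max_le_max (max_le_max (ihp (k + 1)) ihk) ?_
      split_ifs
      · exact Nat.succ_le_succ (ihp k)
      · exact le_rfl

/-- A multiplicative error in the first column does not grow across a block: multiplication by `c`
commutes with maxima, and `c * x + 1 ≤ c * (x + 1)` because `1 ≤ c`. -/
theorem prefixLcs_le_mul_alignTable {s : ℕ → ℕ} {q n : ℕ} {c : ℝ} (hc : 1 ≤ c)
    (hf : ∀ p ≤ n, (prefixLcs a s p q : ℝ) ≤ c * f p) {p : ℕ} (hp : p ≤ n) (k : ℕ) :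
    (prefixLcs a s p (q + k) : ℝ) ≤ c * alignTable a (fun k => s (q + k)) f p k := by
  have hc0 : 0 ≤ c := zero_le_one.trans hc
  induction p generalizing k with
  | zero => simp [prefixLcs]
  | succ p ihp =>
    induction k with
    | zero => simpa using hf _ hp
    | succ k ihk =>
      replace ihp := ihp (by omega)
      rw [alignTable_succ_succ, ← add_assoc, prefixLcs, alignTable_succ_succ, Nat.cast_max,
        Nat.cast_max, Nat.cast_max, Nat.cast_max, mul_max_of_nonneg _ _ hc0,
        mul_max_of_nonneg _ _ hc0]
      refine max_le_max (max_le_max (ihp (k + 1)) ihk) ?_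
      split_ifs
      · have := ihp k
        simp only [prefixLcs] at this
        push_cast
        linarith
      · simp

theorem lcsLength_take_ofFn {n σ : ℕ} (t s : Fin n → Fin σ) (a b : ℕ → ℕ)
    (ha : ∀ i : Fin n, a i = t i) (hb : ∀ i : Fin n, b i = s i) {p q : ℕ} (hp : p ≤ n)
    (hq : q ≤ n) :
    lcsLength ((List.ofFn t).take p) ((List.ofFn s).take q) = prefixLcs a b p q := by
  have key : ∀ (u : Fin n → Fin σ) {m : ℕ} (hm : m < n),
      (List.ofFn u).take (m + 1) = (List.ofFn u).take m ++ [u ⟨m, hm⟩] := fun u m hm => by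
    rw [List.take_succ_eq_append_getElem (by simpa using hm)]
    simp
  induction p generalizing q with
  | zero => simp [lcsLength_nil_left, prefixLcs]
  | succ p ihp =>
    induction q with
    | zero => simp [lcsLength_nil_right, prefixLcs]
    | succ q ihq =>
      have h₁ := ihp (q := q + 1) (by omega) hq
      have h₂ := ihq (by omega)
      have h₃ := ihp (q := q) (by omega) (by omega)
      have hiff : (t ⟨p, hp⟩ = s ⟨q, hq⟩) ↔ b q = a p := by
        rw [show a p = _ from ha ⟨p, hp⟩, show b q = _ from hb ⟨q, hq⟩, Fin.ext_iff, eq_comm]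
      rw [key s hq] at h₁
      rw [key t hp] at h₂
      rw [key t hp, key s hq, lcsLength_concat, h₁, h₂, h₃, prefixLcs, alignTable_succ_succ]
      simp only [hiff]

end Table

/-! ### Thresholds -/

/-- The sequence of thresholds that grows by the factor `1 + 1 / A`. -/
def threshold (A : ℕ) : ℕ → ℕ
  | 0 => 0
  | j + 1 => threshold A j + threshold A j / A + 1

/-- The number of positive thresholds that are at most `v`. -/
def level (A v : ℕ) : ℕ := Nat.findGreatest (fun j => threshold A j ≤ v) v

section Threshold

variable {A : ℕ}

@[simp] theorem threshold_zero : threshold A 0 = 0 := rfl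

theorem threshold_succ (j : ℕ) : threshold A (j + 1) = threshold A j + threshold A j / A + 1 := rfl

theorem threshold_strictMono : StrictMono (threshold A) :=
  strictMono_nat_of_lt_succ fun _ => Nat.lt_succ_of_le (Nat.le_add_right _ _)

/-- This is a Galois connection between levels and values; the search bound `v` in `level` is large
enough because `j ≤ threshold A j`. -/
theorem le_level_iff {j v : ℕ} : j ≤ level A v ↔ threshold A j ≤ v := by
  constructor
  · intro h
    exact (threshold_strictMono.monotone h).trans
      (Nat.findGreatest_spec (P := fun j => threshold A j ≤ v) (Nat.zero_le v) (Nat.zero_le v))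
  · intro h
    exact Nat.le_findGreatest ((threshold_strictMono.le_apply).trans h) h

theorem threshold_level_le (v : ℕ) : threshold A (level A v) ≤ v := le_level_iff.1 le_rfl

theorem level_le (v : ℕ) : level A v ≤ v :=
  threshold_strictMono.le_apply.trans (threshold_level_le v)

@[simp] theorem level_zero : level A 0 = 0 := Nat.le_zero.1 (level_le 0)

theorem level_mono : Monotone (level A) := fun _ _ h =>
  le_level_iff.2 ((threshold_level_le _).trans h)

theorem le_threshold_level (v : ℕ) :
    v ≤ threshold A (level A v) + threshold A (level A v) / A := by
  have h : ¬ (level A v + 1 ≤ level A v) := by omega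
  rw [le_level_iff, threshold_succ] at h
  omega

/-- Rounding down to a threshold loses at most the factor `c`. -/
theorem le_mul_threshold_level {c : ℝ} {n v : ℕ} (hv : v ≤ n)
    (hc : ∀ x ≤ n, ((x / A : ℕ) : ℝ) ≤ (c - 1) * x) : (v : ℝ) ≤ c * threshold A (level A v) := by
  have h₁ : (v : ℝ) ≤ threshold A (level A v) + (threshold A (level A v) / A : ℕ) := by
    exact_mod_cast le_threshold_level v
  have h₂ := hc _ ((threshold_level_le (A := A) v).trans hv)
  linarith

/-- The `+ 1` in the recursion makes up for the rounding down in the division, so the growth is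
truly geometric. -/
theorem pow_le_threshold (hA : 0 < A) (j : ℕ) :
    (1 + 1 / (A : ℝ)) ^ j ≤ threshold A (j + 1) := by
  have hA' : (0 : ℝ) < A := by exact_mod_cast hA
  induction j with
  | zero => simp [threshold_succ]
  | succ j ih =>
    have h : (threshold A (j + 1) : ℝ) / A ≤ (threshold A (j + 1) / A : ℕ) + 1 := by
      rw [← Nat.floor_div_eq_div (K := ℝ)]
      exact (Nat.lt_floor_add_one _).le
    rw [threshold_succ, pow_succ]
    push_cast
    calc _ ≤ (threshold A (j + 1) : ℝ) * (1 + 1 / A) := by gcongr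
      _ = threshold A (j + 1) + threshold A (j + 1) / A := by ring
      _ ≤ _ := by rw [add_assoc]; linarith

/-- The number of thresholds up to `n` is `O(A log n)`. -/
theorem level_le_log (hA : 0 < A) {n : ℕ} (hn : 1 ≤ n) :
    (level A n : ℝ) ≤ 1 + 2 * A * Real.log n := by
  have hA' : (1 : ℝ) ≤ A := by exact_mod_cast hA
  have hlog : 0 ≤ Real.log n := Real.log_nonneg (by exact_mod_cast hn)
  rcases Nat.eq_zero_or_pos (level A n) with h0 | hpos
  · rw [h0]; push_cast; positivity
  obtain ⟨j, hj⟩ := Nat.exists_eq_succ_of_ne_zero hpos.ne'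
  have hpow : (1 + 1 / (A : ℝ)) ^ j ≤ n := by
    refine (pow_le_threshold hA j).trans ?_
    have := threshold_level_le (A := A) n
    rw [hj] at this
    exact_mod_cast this
  have h₁ : j * Real.log (1 + 1 / (A : ℝ)) ≤ Real.log n := by
    rw [← Real.log_pow]
    exact Real.log_le_log (by positivity) hpow
  -- From `1 - 1/x ≤ log x` at `x = 1 + 1/A`, which gives `1/(A + 1)`.
  have h₂ : 1 / (2 * (A : ℝ)) ≤ Real.log (1 + 1 / A) := by
    have h := Real.one_sub_inv_le_log_of_pos (x := 1 + 1 / (A : ℝ)) (by positivity)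
    refine le_trans ?_ h
    have : 1 - (1 + 1 / (A : ℝ))⁻¹ = 1 / (A + 1) := by field_simp; ring
    rw [this]
    exact one_div_le_one_div_of_le (by positivity) (by linarith)
  have h₃ : (j : ℝ) * (1 / (2 * A)) ≤ Real.log n :=
    (mul_le_mul_of_nonneg_left h₂ (Nat.cast_nonneg j)).trans h₁
  rw [mul_one_div, div_le_iff₀ (by positivity)] at h₃
  rw [hj]
  push_cast
  linarith

end Threshold

/-! ### First positions at which a monotone function reaches a level -/

/-- The first `p ≤ N` with `i ≤ u p`, or `0` if there is none. -/
noncomputable def firstHit (u : ℕ → ℕ) (N i : ℕ) : ℕ :=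
  open Classical in if h : ∃ p, p ≤ N ∧ i ≤ u p then Nat.find h else 0

section FirstHit

variable {u : ℕ → ℕ} {N : ℕ}

theorem firstHit_le (u : ℕ → ℕ) (N i : ℕ) : firstHit u N i ≤ N := by
  classical
  unfold firstHit
  split_ifs with h
  · exact (Nat.find_spec h).1
  · exact Nat.zero_le _

theorem firstHit_eq_zero_of_lt (hu : Monotone u) {i : ℕ} (hi : u N < i) : firstHit u N i = 0 := by
  classical
  refine dif_neg ?_
  rintro ⟨p, hp, h⟩
  have := hu hp
  omega

theorem firstHit_eq_zero_of_le {i : ℕ} (hi : i ≤ u 0) : firstHit u N i = 0 := by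
  classical
  have h : ∃ p, p ≤ N ∧ i ≤ u p := ⟨0, Nat.zero_le _, hi⟩
  rw [firstHit, dif_pos h]
  exact (Nat.find_eq_zero h).2 ⟨Nat.zero_le _, hi⟩

/-- This is how stored positions are decoded: once level `i` is known not to be reached at `p`, a
single equality test tells whether it is reached at `p + 1`. The default value `0` cannot be
mistaken for a hit, since `p + 1` is positive. -/
theorem firstHit_eq_succ_iff (hu : Monotone u) {p i : ℕ} (hp : p < N) (hi : u p < i) :
    firstHit u N i = p + 1 ↔ i ≤ u (p + 1) := by
  classical
  constructor
  · intro h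
    unfold firstHit at h
    split_ifs at h with hex
    exact h ▸ (Nat.find_spec hex).2
  · intro h
    have hex : ∃ p, p ≤ N ∧ i ≤ u p := ⟨p + 1, hp, h⟩
    rw [firstHit, dif_pos hex, Nat.find_eq_iff]
    refine ⟨⟨hp, h⟩, fun r hr hcon => ?_⟩
    have := hu (Nat.lt_succ_iff.1 hr)
    omega

/-- This is how positions are encoded during a sweep: one more position changes exactly the entries
of the levels it newly reaches. -/
theorem firstHit_succ (hu : Monotone u) (i : ℕ) : firstHit u (N + 1) i =
    if u N < i ∧ i ≤ u (N + 1) then N + 1 else firstHit u N i := by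
  classical
  split_ifs with h
  · exact (firstHit_eq_succ_iff hu (Nat.lt_succ_self N) h.1).2 h.2
  · by_cases hi : i ≤ u N
    · have h₁ : ∃ p, p ≤ N ∧ i ≤ u p := ⟨N, le_rfl, hi⟩
      have h₂ : ∃ p, p ≤ N + 1 ∧ i ≤ u p := ⟨N, Nat.le_succ _, hi⟩
      rw [firstHit, firstHit, dif_pos h₁, dif_pos h₂, Nat.find_eq_iff]
      refine ⟨⟨(Nat.find_spec h₁).1.trans (Nat.le_succ _), (Nat.find_spec h₁).2⟩, ?_⟩
      intro r hr hcon
      exact Nat.find_min h₁ hr ⟨(hr.le.trans (Nat.find_spec h₁).1), hcon.2⟩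
    · rw [firstHit_eq_zero_of_lt hu (by omega), firstHit_eq_zero_of_lt hu (by omega)]

end FirstHit

/-! ### The program -/

/-- The scalar variable with number `a`. -/
def Expr.var (a : ℕ) : Expr := .load (.const a)

/-- The register of the entry with index `e` of the array variable with number `a`. -/
def Expr.cell (a : ℕ) (e : Expr) : Expr := .add (.const a) (.mul (.const 16) e)

/-- The entry with index `e` of the array variable with number `a`. -/
def Expr.entry (a : ℕ) (e : Expr) : Expr := .load (.cell a e)

/-- The maximum of two expressions. -/
def Expr.max (e₁ e₂ : Expr) : Expr := .add e₁ (.sub e₂ e₁)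

/-- The successor of an expression. -/
def Expr.succ (e : Expr) : Expr := .add e (.const 1)

/-- Assignment to the scalar variable with number `a`. -/
def Program.set (a : ℕ) (e : Expr) : Program := .store (.const a) e

section Eval

variable {I : Input} {M : Memory} {a : ℕ} {e e₁ e₂ : Expr}

theorem Expr.eval_var : (Expr.var a).eval I M = M a := rfl

theorem Expr.eval_cell : (Expr.cell a e).eval I M = a + 16 * e.eval I M := rfl

theorem Expr.eval_entry : (Expr.entry a e).eval I M = M (a + 16 * e.eval I M) := rfl

theorem Expr.eval_succ : (Expr.succ e).eval I M = e.eval I M + 1 := rfl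

theorem Expr.eval_max : (Expr.max e₁ e₂).eval I M = Max.max (e₁.eval I M) (e₂.eval I M) := by
  simp only [Expr.max, Expr.eval]
  omega

end Eval

/-- The threshold that follows the threshold `e`, minus one. -/
def Expr.nextThreshold (e : Expr) : Expr := .add e (.div e (.var 3))

/-- The block length. -/
def Expr.blockLen : Expr := .succ (.div .len (.var 1))

/-- Reading a block of the online string. -/
def fetch : Program :=
  .loop (.mul (.lt (.var 5) .blockLen) (.lt (.var 4) .len))
    (.seq (.receive (.cell 12 (.var 5)))
    (.seq (.set 5 (.succ (.var 5)))
    (.seq (.store (.cell 13 (.var 5)) (.const 0))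
      (.set 4 (.succ (.var 4))))))

/-- Advancing the first column of the table. -/
def advance : Program :=
  .loop (.eq (.entry 14 (.succ (.var 7))) (.var 6))
    (.seq (.set 7 (.succ (.var 7)))
      (.set 8 (.succ (.nextThreshold (.var 8)))))

/-- Computing the next row of the table. -/
def fillRow : Program :=
  .loop (.lt (.var 9) (.var 5))
    (.seq (.set 2 (.max (.max (.entry 13 (.succ (.var 9))) (.entry 13 (.var 9)))
      (.mul (.eq (.entry 12 (.var 9)) (.query (.sub (.var 6) (.const 1)))) (.succ (.var 10)))))
    (.seq (.set 10 (.entry 13 (.succ (.var 9))))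
    (.seq (.store (.cell 13 (.succ (.var 9))) (.var 2))
    (.seq (.set 2 (.const 0))
      (.set 9 (.succ (.var 9)))))))

/-- Recording the thresholds that the last column of the table has reached. -/
def recordHits : Program :=
  .loop (.lt (.nextThreshold (.var 0)) (.entry 13 (.var 5)))
    (.seq (.set 11 (.succ (.var 11)))
    (.seq (.set 0 (.succ (.nextThreshold (.var 0))))
      (.store (.cell 15 (.var 11)) (.var 6))))

/-- Processing one character of the offline string. -/
def sweepStep : Program :=
  .seq (.set 6 (.succ (.var 6)))
  (.seq advance
  (.seq (.set 10 (.entry 13 (.const 0)))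
  (.seq (.store (.cell 13 (.const 0)) (.var 8))
  (.seq fillRow
  (.seq recordHits
  (.seq (.set 9 (.const 0))
    (.set 10 (.const 0))))))))

/-- Processing the offline string. -/
def sweep : Program := .loop (.lt (.var 6) .len) sweepStep

/-- Replacing the old positions by the new ones. -/
def copyBack : Program :=
  .loop (.lt (.const 0) (.var 11))
    (.seq (.store (.cell 14 (.var 11)) (.entry 15 (.var 11)))
    (.seq (.store (.cell 15 (.var 11)) (.const 0))
      (.set 11 (.sub (.var 11) (.const 1)))))

/-- Processing one block. -/
def processBlock : Program :=
  .seq (.set 5 (.const 0))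
  (.seq (.store (.cell 13 (.const 0)) (.const 0))
  (.seq fetch
  (.seq (.set 6 (.const 0))
  (.seq (.set 7 (.const 0))
  (.seq (.set 8 (.const 0))
  (.seq (.set 0 (.const 0))
  (.seq sweep copyBack)))))))

/-- Computing the integer square root of the length. -/
def computeSqrt : Program :=
  .loop (.lt (.mul (.succ (.var 1)) (.succ (.var 1))) (.succ .len)) (.set 1 (.succ (.var 1)))

/-- Computing the growth parameter of the thresholds from the expression `den`. The accuracy
parameter is not read when the strings have length one. -/
def computeGrowth (den : Expr) : Program :=
  .ite (.lt .len (.const 2)) (.set 3 (.const 2))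
    (.ite (.lt den (.succ .len)) (.set 3 den) (.set 3 (.succ .len)))

/-- The streaming algorithm for the longest common subsequence. -/
def lcsProgram (den : Expr) : Program :=
  .seq computeSqrt (.seq (computeGrowth den) (.loop (.lt (.var 4) .len) processBlock))

/-! ### Correctness of the inner loops -/

section Correctness

variable {I : Input} {N w W : ℕ}

theorem Exec.set (hI : Ambient I N w W) {a : ℕ} {e : Expr} {σ σ' : Vars} {l : List ℕ} {v : ℕ}
    (ha : ((Expr.const a).tame && (Expr.const a).accuracyFree) = true)
    (he : (e.tame && e.accuracyFree) = true) (hev : Evals I N w e σ v)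
    (hrep : ∀ M, Rep N w σ M → Rep N w σ' (M.update a v)) :
    Exec I N w W (.set a e) σ l σ' l :=
  Exec.store (fits_of_accuracyFree hI ha) (fits_of_accuracyFree hI he) (fun _ _ => rfl) hev hrep

theorem Exec.setCell (hI : Ambient I N w W) {a : ℕ} {i e : Expr} {σ σ' : Vars} {l : List ℕ}
    {k v : ℕ} (hi : ((Expr.cell a i).tame && (Expr.cell a i).accuracyFree) = true)
    (he : (e.tame && e.accuracyFree) = true) (hiv : Evals I N w i σ k) (hev : Evals I N w e σ v)
    (hrep : ∀ M, Rep N w σ M → Rep N w σ' (M.update (a + 16 * k) v)) :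
    Exec I N w W (.store (.cell a i) e) σ l σ' l :=
  Exec.store (fits_of_accuracyFree hI hi) (fits_of_accuracyFree hI he)
    (fun M h => by rw [Expr.eval_cell, hiv M h]) hev hrep

/-- By `firstHit_eq_succ_iff` the loop test asks whether the next level is reached at `p + 1`, so
the loop stops at `u (p + 1)`, also when several levels are passed at once. -/
theorem exec_advance (hI : Ambient I N w W) {σ : Vars} {l : List ℕ} {u : ℕ → ℕ} {A p : ℕ}
    (hu : Monotone u) (hp : p < I.len) (hle : threshold A (u (p + 1)) ≤ I.len)
    (hP : σ.P = firstHit u I.len) (hi : σ.i = u p) (htf : σ.tf = threshold A (u p))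
    (hσp : σ.p = p + 1) (hA : σ.A = A) :
    Exec I N w W advance σ l { σ with i := u (p + 1), tf := threshold A (u (p + 1)) } l := by
  have hlen := hI.len_lt
  have hup : u p ≤ u (p + 1) := hu (Nat.le_succ p)
  refine Exec.loop
    (fun x => { σ with i := u p + x, tf := threshold A (u p + x) }) (fun _ => l) (u (p + 1) - u p)
    ?_ ?_ rfl rfl (fits_of_accuracyFree hI rfl) ?_ ?_ ?_
  · cases σ; simp_all
  · simp only [Nat.add_sub_cancel' hup]
  · intro x hx M hM
    have := (firstHit_eq_succ_iff hu hp (i := u p + x + 1) (by omega)).2 (by omega)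
    simp only [Expr.eval, Expr.eval_entry, Expr.eval_succ, Expr.eval_var, hM.i, hM.p, hM.P, hP,
      hσp, this]
    simp
  · intro M hM
    have := (firstHit_eq_succ_iff hu hp (i := u (p + 1) + 1) (by omega)).not.2 (by omega)
    simp only [Expr.eval, Expr.eval_entry, Expr.eval_succ, Expr.eval_var, hM.i, hM.p, hM.P, hP,
      hσp, Nat.add_sub_cancel' hup, if_neg this]
  · intro x hx
    have h₁ : threshold A (u p + (x + 1)) ≤ threshold A (u (p + 1)) :=
      threshold_strictMono.monotone (by omega)
    have h₂ : u p + (x + 1) ≤ threshold A (u p + (x + 1)) := threshold_strictMono.le_apply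
    refine (Exec.set hI rfl rfl (v := u p + (x + 1)) (fun M hM => ?_)
      fun M hM => hM.set_i hI.pos (by omega)).seq
      (Exec.set hI rfl rfl (v := threshold A (u p + (x + 1))) (fun M hM => ?_)
      fun M hM => hM.set_tf hI.pos (by omega))
    · simp only [Expr.eval_succ, Expr.eval_var, hM.i, add_assoc]
    · simp only [Expr.eval_succ, Expr.eval_var, Expr.nextThreshold, Expr.eval, hM.tf, hM.A, hA,
        ← add_assoc, threshold_succ]

/-- The row is overwritten in place: entries up to `k` already belong to row `p + 1` and later ones
still to row `p`, while `d` keeps the overwritten entry of row `p` that the diagonal term needs. -/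
theorem exec_fillRow (hI : Ambient I N w W) {σ : Vars} {l : List ℕ} {b f : ℕ → ℕ} {m p : ℕ}
    (hp : p < I.len) (hmN : m < N) (hmn : m ≤ I.len) (hf : ∀ p, f p ≤ p)
    (hm : σ.m = m) (hσp : σ.p = p + 1) (he : σ.e = 0) (hk : σ.k = 0)
    (hd : σ.d = alignTable I.offline b f p 0) (hb : ∀ k < m, σ.b k = b k)
    (hL0 : σ.L 0 = alignTable I.offline b f (p + 1) 0)
    (hL : ∀ k, 1 ≤ k → k ≤ m → σ.L k = alignTable I.offline b f p k) :
    Exec I N w W fillRow σ l { σ with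
      k := m
      d := alignTable I.offline b f p m
      L := fun k => if k ≤ m then alignTable I.offline b f (p + 1) k else σ.L k } l := by
  have hlen := hI.len_lt
  have hD := alignTable_le (a := I.offline) (b := b) hf
  refine Exec.loop
    (fun x => { σ with
      k := x
      d := alignTable I.offline b f p x
      L := fun k => if k ≤ x then alignTable I.offline b f (p + 1) k else σ.L k }) (fun _ => l) m
    ?_ ?_ rfl rfl (fits_of_accuracyFree hI rfl) ?_ ?_ ?_
  · have : (fun k => if k ≤ 0 then alignTable I.offline b f (p + 1) k else σ.L k) = σ.L := by
      funext k
      split_ifs with h0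
      · rw [Nat.le_zero.1 h0, hL0]
      · rfl
    simp only [this, ← hd]
    simp only [← hk]
  · rfl
  · intro x hx M hM
    simp only [Expr.eval, Expr.eval_var, hM.k, hM.m, hm, hx, if_true]
    simp
  · intro M hM
    simp only [Expr.eval, Expr.eval_var, hM.k, hM.m, hm, lt_irrefl, if_false]
  · intro x hx
    have h1 := hD (p + 1) (x + 1)
    have h2 := hD p (x + 1)
    refine Exec.of_eq (
      (Exec.set hI rfl rfl (v := alignTable I.offline b f (p + 1) (x + 1)) (fun M hM => ?_)
        fun M hM => hM.set_e hI.pos (by omega)).seq <|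
      (Exec.set hI rfl rfl (v := alignTable I.offline b f p (x + 1)) (fun M hM => ?_)
        fun M hM => hM.set_d hI.pos (by omega)).seq <|
      (Exec.setCell hI rfl rfl (k := x + 1) (v := alignTable I.offline b f (p + 1) (x + 1))
        (fun M hM => ?_) (fun M hM => ?_) fun M hM => hM.set_L (by omega) (by omega)).seq <|
      (Exec.set hI rfl rfl (v := 0) (fun M hM => ?_)
        fun M hM => hM.set_e hI.pos (by omega)).seq <|
      (Exec.set hI rfl rfl (v := x + 1) (fun M hM => ?_)
        fun M hM => hM.set_k hI.pos (by omega))) ?_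
    -- The variable `p` counts from one, hence the query at `p + 1 - 1`. The conditional of the
    -- recurrence is the product of the comparison bit with `d + 1`.
    · simp only [Expr.eval, Expr.eval_entry, Expr.eval_succ, Expr.eval_var, Expr.eval_max, hM.k,
        hM.p, hM.b, hM.L, hM.d, hσp, hb x hx, hL (x + 1) (by omega) hx, alignTable_succ_succ,
        Nat.add_sub_cancel, le_refl, if_true, Nat.not_succ_le_self, if_false]
      split_ifs <;> simp
    · simp only [Expr.eval_entry, Expr.eval_succ, Expr.eval_var, hM.k, hM.L,
        hL (x + 1) (by omega) hx, Nat.not_succ_le_self, if_false]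
    · simp only [Expr.eval_succ, Expr.eval_var, hM.k]
    · simp only [Expr.eval_var, hM.e]
    · rfl
    · simp only [Expr.eval_succ, Expr.eval_var, hM.k]
    · simp only [Vars.mk.injEq, true_and, and_true]
      refine ⟨he.symm, ?_⟩
      funext k
      rw [Function.update_apply]
      split_ifs <;> first | rfl | omega | simp_all

/-- `nextThreshold` omits the final `+ 1`, so the strict test means that threshold `j + 1` is at
most the last entry of the row. The loop therefore stops at the level of that entry, and all levels
passed receive the position `p + 1`. -/
theorem exec_recordHits (hI : Ambient I N w W) {σ : Vars} {l : List ℕ} {A m p v v' : ℕ}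
    (hp : p < I.len) (hN : level A I.len < N) (hv : v ≤ v') (hLn : σ.L m ≤ I.len)
    (hm : σ.m = m) (hσp : σ.p = p + 1) (hA : σ.A = A) (hj : σ.j = v) (htg : σ.tg = threshold A v)
    (hL : v' = level A (σ.L m)) :
    Exec I N w W recordHits σ l { σ with
      j := v'
      tg := threshold A v'
      Q := fun i => if v < i ∧ i ≤ v' then p + 1 else σ.Q i } l := by
  have hlen := hI.len_lt
  have hv'N : v' < N := hL ▸ (level_mono hLn).trans_lt hN
  have hv'n : threshold A v' ≤ I.len := hL ▸ (threshold_level_le _).trans hLn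
  refine Exec.loop
    (fun x => { σ with
      j := v + x
      tg := threshold A (v + x)
      Q := fun i => if v < i ∧ i ≤ v + x then p + 1 else σ.Q i }) (fun _ => l) (v' - v)
    ?_ ?_ rfl rfl (fits_of_accuracyFree hI rfl) ?_ ?_ ?_
  · have : (fun i => if v < i ∧ i ≤ v + 0 then p + 1 else σ.Q i) = σ.Q := by
      funext i
      exact if_neg (by omega)
    simp only [this]
    simp only [add_zero, ← htg]
    simp only [← hj]
  · simp only [Nat.add_sub_cancel' hv]
  · intro x hx M hM
    have : threshold A (v + x + 1) ≤ σ.L m := le_level_iff.1 (by omega)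
    rw [threshold_succ] at this
    simp only [Expr.eval, Expr.eval_entry, Expr.nextThreshold, Expr.eval_var, hM.tg, hM.A, hM.m,
      hM.L, hA, hm]
    rw [if_pos (by omega)]
    exact one_ne_zero
  · intro M hM
    have : ¬ threshold A (v' + 1) ≤ σ.L m := by rw [← le_level_iff]; omega
    rw [threshold_succ] at this
    simp only [Expr.eval, Expr.eval_entry, Expr.nextThreshold, Expr.eval_var, hM.tg, hM.A, hM.m,
      hM.L, hA, hm, Nat.add_sub_cancel' hv]
    rw [if_neg (by omega)]
  · intro x hx
    have h₁ : threshold A (v + (x + 1)) ≤ threshold A v' :=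
      threshold_strictMono.monotone (by omega)
    have h₂ : v' ≤ threshold A v' := threshold_strictMono.le_apply
    refine Exec.of_eq (
      (Exec.set hI rfl rfl (v := v + (x + 1)) (fun M hM => ?_)
        fun M hM => hM.set_j hI.pos (by omega)).seq <|
      (Exec.set hI rfl rfl (v := threshold A (v + (x + 1))) (fun M hM => ?_)
        fun M hM => hM.set_tg hI.pos (by omega)).seq <|
      (Exec.setCell hI rfl rfl (k := v + (x + 1)) (v := p + 1)
        (fun M hM => ?_) (fun M hM => ?_) fun M hM => hM.set_Q (by omega) (by omega))) ?_
    · simp only [Expr.eval_succ, Expr.eval_var, hM.j, add_assoc]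
    · simp only [Expr.eval_succ, Expr.eval_var, Expr.nextThreshold, Expr.eval, hM.tg, hM.A, hA,
        ← add_assoc, threshold_succ]
    · simp only [Expr.eval_var, hM.j]
    · simp only [Expr.eval_var, hM.p, hσp]
    · simp only [Vars.mk.injEq, true_and]
      funext i
      rw [Function.update_apply]
      split_ifs <;> first | rfl | omega

theorem exec_copyBack (hI : Ambient I N w W) {σ : Vars} {l : List ℕ}
    (hN : σ.j < N) (hQ : ∀ i, σ.Q i < 2 ^ w) :
    Exec I N w W copyBack σ l { σ with
      j := 0
      P := fun i => if 0 < i ∧ i ≤ σ.j then σ.Q i else σ.P i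
      Q := fun i => if 0 < i ∧ i ≤ σ.j then 0 else σ.Q i } l := by
  refine Exec.loop
    (fun x => { σ with
      j := σ.j - x
      P := fun i => if σ.j - x < i ∧ i ≤ σ.j then σ.Q i else σ.P i
      Q := fun i => if σ.j - x < i ∧ i ≤ σ.j then 0 else σ.Q i }) (fun _ => l) σ.j
    ?_ ?_ rfl rfl (fits_of_accuracyFree hI rfl) ?_ ?_ ?_
  · have h₁ : ∀ F G : ℕ → ℕ, (fun i => if σ.j - 0 < i ∧ i ≤ σ.j then F i else G i) = G := by
      intro F G
      funext i
      exact if_neg (by omega)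
    simp only [h₁ σ.Q σ.P, h₁ (fun _ => 0) σ.Q]
    simp only [Nat.sub_zero]
  · simp only [Nat.sub_self]
  · intro x hx M hM
    simp only [Expr.eval, Expr.eval_var, hM.j]
    rw [if_pos (by omega)]
    exact one_ne_zero
  · intro M hM
    simp only [Expr.eval, Expr.eval_var, hM.j]
    rw [if_neg (by omega)]
  · intro x hx
    have hpos := Nat.two_pow_pos w
    refine Exec.of_eq (
      (Exec.setCell hI rfl rfl (k := σ.j - x) (v := σ.Q (σ.j - x))
        (fun M hM => ?_) (fun M hM => ?_) fun M hM => hM.set_P (by omega) (hQ _)).seq <|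
      (Exec.setCell hI rfl rfl (k := σ.j - x) (v := 0)
        (fun M hM => ?_) (fun M hM => rfl) fun M hM => hM.set_Q (by omega) hpos).seq <|
      (Exec.set hI rfl rfl (v := σ.j - (x + 1)) (fun M hM => ?_)
        fun M hM => hM.set_j hI.pos ?_)) ?_
    · simp only [Expr.eval_var, hM.j]
    · simp only [Expr.eval_entry, Expr.eval_var, hM.j, hM.Q]
      rw [if_neg (by omega)]
    · simp only [Expr.eval_var, hM.j]
    · simp only [Expr.eval, Expr.eval_var, hM.j]
      omega
    -- The bound on the new value of `j` comes from the register that holds the old one.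
    · have := hM.bits 11
      rw [hM.j] at this
      simp only at this
      omega
    · simp only [Vars.mk.injEq, true_and]
      constructor <;>
      · funext i
        rw [Function.update_apply]
        split_ifs with h1 h2 h3 <;> first | rfl | omega | (rw [h1])

end Correctness

/-! ### Processing one block -/

section Block

variable {I : Input} {N w W : ℕ}

/-- The part of the string `s` of length `n` that follows the first `r` characters. -/
def streamFrom (s : ℕ → ℕ) (n r : ℕ) : List ℕ := (List.range' r (n - r)).map s

theorem streamFrom_of_lt (s : ℕ → ℕ) {n r : ℕ} (h : r < n) :
    streamFrom s n r = s r :: streamFrom s n (r + 1) := by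
  rw [streamFrom, show n - r = (n - (r + 1)) + 1 by omega, List.range'_succ, List.map_cons,
    streamFrom]

/-- The test is a product of two bits, so reading stops when the block is full or the stream is
exhausted. The array `L` is cleared on the way, which makes it row `0` of the table. -/
theorem exec_fetch (hI : Ambient I N w W) {σ : Vars} {s : ℕ → ℕ} {T : ℕ}
    (hs : ∀ i, s i < 2 ^ w) (hT : T = min (I.len / σ.q + 1) (I.len - σ.r)) (hN : T < N)
    (hr : σ.r ≤ I.len) (hm : σ.m = 0) (hL : σ.L 0 = 0) :
    Exec I N w W fetch σ (streamFrom s I.len σ.r) { σ with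
      m := T
      r := σ.r + T
      b := fun k => if k < T then s (σ.r + k) else σ.b k
      L := fun k => if k ≤ T then 0 else σ.L k } (streamFrom s I.len (σ.r + T)) := by
  have hlen := hI.len_lt
  have hpos := Nat.two_pow_pos w
  refine Exec.loop
    (fun x => { σ with
      m := x
      r := σ.r + x
      b := fun k => if k < x then s (σ.r + k) else σ.b k
      L := fun k => if k ≤ x then 0 else σ.L k }) (fun x => streamFrom s I.len (σ.r + x)) T
    ?_ rfl rfl rfl (fits_of_accuracyFree hI rfl) ?_ ?_ ?_
  · have h₁ : (fun k => if k ≤ 0 then 0 else σ.L k) = σ.L := by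
      funext k
      split_ifs with h0
      · rw [Nat.le_zero.1 h0, hL]
      · rfl
    simp only [h₁, Nat.not_lt_zero, if_false, add_zero]
    simp only [← hm]
  · intro x hx M hM
    simp only [Expr.eval, Expr.eval_var, Expr.blockLen, Expr.eval_succ, hM.m, hM.r, hM.q]
    rw [if_pos (by omega), if_pos (by omega)]
    exact one_ne_zero
  · intro M hM
    simp only [Expr.eval, Expr.eval_var, Expr.blockLen, Expr.eval_succ, hM.m, hM.r, hM.q]
    rcases le_total (I.len / σ.q + 1) (I.len - σ.r) with h | h
    · rw [if_neg (by omega), zero_mul]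
    · rw [if_neg (c := σ.r + T < I.len) (by omega), mul_zero]
  · intro x hx
    simp only [streamFrom_of_lt s (show σ.r + x < I.len by omega)]
    refine Exec.of_eq (
      (Exec.receive hI (addr := 12 + 16 * x) (fits_of_accuracyFree hI rfl) (fun M hM => ?_)
        (hs _) fun M hM => hM.set_b (by omega) (hs _)).seq <|
      (Exec.set hI rfl rfl (v := x + 1) (fun M hM => ?_)
        fun M hM => hM.set_m hI.pos (by omega)).seq <|
      (Exec.setCell hI rfl rfl (k := x + 1) (v := 0) (fun M hM => ?_) (fun M hM => rfl)
        fun M hM => hM.set_L (by omega) hpos).seq <|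
      (Exec.set hI rfl rfl (v := σ.r + (x + 1)) (fun M hM => ?_)
        fun M hM => hM.set_r hI.pos (by omega))) ?_
    · simp only [Expr.eval_cell, Expr.eval_var, hM.m]
    · simp only [Expr.eval_succ, Expr.eval_var, hM.m]
    · simp only [Expr.eval_var, hM.m]
    · simp only [Expr.eval_succ, Expr.eval_var, hM.r, add_assoc]
    · simp only [Vars.mk.injEq, true_and, and_true]
      constructor <;>
      · funext k
        rw [Function.update_apply]
        split_ifs with h1 h2 h3 <;> first | rfl | omega | rw [h1]

/-- The state of the sweep over the offline string after `x` characters. -/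
noncomputable def sweepState (A m : ℕ) (a b u : ℕ → ℕ) (σ : Vars) (x : ℕ) : Vars :=
  { σ with
    p := x
    i := u x
    tf := threshold A (u x)
    L := fun k => if k ≤ m then alignTable a b (fun p => threshold A (u p)) x k else σ.L k
    j := level A (alignTable a b (fun p => threshold A (u p)) x m)
    tg := threshold A (level A (alignTable a b (fun p => threshold A (u p)) x m))
    Q := firstHit (fun x => level A (alignTable a b (fun p => threshold A (u p)) x m)) x }

theorem exec_sweepStep (hI : Ambient I N w W) {σ : Vars} {l : List ℕ} {A m x : ℕ} {b u : ℕ → ℕ}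
    (hN : level A I.len < N) (hmN : m < N) (hmn : m ≤ I.len) (hu : Monotone u)
    (hle : ∀ p, threshold A (u p) ≤ p) (hx : x < I.len)
    (hA : σ.A = A) (hm : σ.m = m) (he : σ.e = 0) (hk : σ.k = 0) (hd : σ.d = 0)
    (hb : ∀ k < m, σ.b k = b k) (hP : σ.P = firstHit u I.len) :
    Exec I N w W sweepStep (sweepState A m I.offline b u σ x) l
      (sweepState A m I.offline b u σ (x + 1)) l := by
  have hlen := hI.len_lt
  have hpos := Nat.two_pow_pos w
  set f : ℕ → ℕ := fun p => threshold A (u p) with hf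
  have hfmono : Monotone f := fun _ _ h => threshold_strictMono.monotone (hu h)
  have hD := alignTable_le (a := I.offline) (b := b) hle
  have hDx : alignTable I.offline b f x 0 ≤ x := hD x 0
  have hmono : Monotone fun x => level A (alignTable I.offline b f x m) := fun _ _ h =>
    level_mono (alignTable_mono hfmono m h)
  have hf' : f (x + 1) = alignTable I.offline b f (x + 1) 0 := (alignTable_succ_zero x).symm
  have hfx : f (x + 1) ≤ x + 1 := hle (x + 1)
  have hDm := hD (x + 1) m
  refine Exec.of_eq (
    (Exec.set hI rfl rfl (v := x + 1) (fun M hM => ?_)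
      fun M hM => hM.set_p hI.pos (by omega)).seq <|
    (exec_advance hI hu hx (hfx.trans hx) (by exact hP) rfl rfl rfl (by exact hA)).seq <|
    (Exec.set hI rfl rfl (v := alignTable I.offline b f x 0) (fun M hM => ?_)
      fun M hM => hM.set_d hI.pos (by omega)).seq <|
    (Exec.setCell hI rfl rfl (k := 0) (v := f (x + 1)) (fun M hM => rfl) (fun M hM => ?_)
      fun M hM => hM.set_L hI.pos (by omega)).seq <|
    (exec_fillRow hI hx hmN hmn hle (by exact hm) rfl (by exact he) (by exact hk) rfl
      (by exact hb) ?_ ?_).seq <|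
    (exec_recordHits (m := m) hI hx hN (hmono (Nat.le_succ x)) ?_ (by exact hm) rfl
      (by exact hA) rfl rfl ?_).seq <|
    (Exec.set hI rfl rfl (v := 0) (fun M hM => rfl) fun M hM => hM.set_k hI.pos hpos).seq <|
    (Exec.set hI rfl rfl (v := 0) (fun M hM => rfl) fun M hM => hM.set_d hI.pos hpos)) ?_
  · simp only [Expr.eval_succ, Expr.eval_var, hM.p, sweepState]
  · simp only [Expr.eval_entry, Expr.eval, hM.L, sweepState, Nat.zero_le, if_true, hf]
  · simp only [Expr.eval_var, hM.tf, hf]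
  · simp only [Function.update_self, hf']
    rfl
  · intro k hk1 hkm
    simp only [Function.update_apply, sweepState, if_pos hkm]
    exact if_neg (by omega)
  · simp only [le_refl, if_true]
    omega
  · simp only [le_refl, if_true]
    rfl
  · simp only [sweepState, Vars.mk.injEq, true_and]
    refine ⟨rfl, hk.symm, hd.symm, rfl, ?_, ?_⟩
    · funext k
      simp only [Function.update_apply]
      split_ifs <;> first | rfl | omega
    · funext i
      exact (firstHit_succ hmono i).symm

theorem exec_sweep (hI : Ambient I N w W) {σ : Vars} {l : List ℕ} {A m : ℕ} {b u : ℕ → ℕ}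
    (hN : level A I.len < N) (hmN : m < N) (hmn : m ≤ I.len) (hu : Monotone u)
    (hle : ∀ p, threshold A (u p) ≤ p)
    (hA : σ.A = A) (hm : σ.m = m) (he : σ.e = 0) (hk : σ.k = 0) (hd : σ.d = 0)
    (hb : ∀ k < m, σ.b k = b k) (hP : σ.P = firstHit u I.len)
    (hp : σ.p = 0) (hi : σ.i = 0) (htf : σ.tf = 0) (hj : σ.j = 0) (htg : σ.tg = 0)
    (hL : ∀ k ≤ m, σ.L k = 0) (hQ : σ.Q = fun _ => 0) :
    Exec I N w W sweep σ l (sweepState A m I.offline b u σ I.len) l := by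
  -- `u 0 ≤ threshold A (u 0) ≤ 0`; this makes the cleared variables the correct start of the sweep.
  have hu0 : u 0 = 0 :=
    Nat.le_zero.1 (threshold_strictMono.le_apply.trans (hle 0))
  refine Exec.loop (sweepState A m I.offline b u σ) (fun _ => l) I.len
    ?_ rfl rfl rfl (fits_of_accuracyFree hI rfl) ?_ ?_ ?_
  · have hL' : (fun k => if k ≤ m then
        alignTable I.offline b (fun p => threshold A (u p)) 0 k else σ.L k) = σ.L := by
      funext k
      split_ifs with h
      · rw [alignTable_zero, hL k h]
      · rfl
    have hQ' : firstHit (fun x => level A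
        (alignTable I.offline b (fun p => threshold A (u p)) x m)) 0 = σ.Q := by
      funext i
      rw [hQ]
      exact Nat.le_zero.1 (firstHit_le _ _ _)
    simp only [sweepState, hQ', hu0, alignTable_zero, level_zero, threshold_zero]
    cases σ
    simp_all
  · intro x hx M hM
    simp only [Expr.eval, Expr.eval_var, hM.p, sweepState, hx, if_true]
    exact one_ne_zero
  · intro M hM
    simp only [Expr.eval, Expr.eval_var, hM.p, sweepState, lt_irrefl, if_false]
  · intro x hx
    exact exec_sweepStep hI hN hmN hmn hu hle hx hA hm he hk hd hb hP

/-- The state between two blocks, after the first `r` characters of the online string: the array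
`P` holds the first positions at which the function `u` reaches its values, and `threshold ∘ u`
approximates the lengths of longest common subsequences within the factor `C`. -/
structure BlockState (I : Input) (s : ℕ → ℕ) (A : ℕ) (C : ℝ) (u : ℕ → ℕ) (σ : Vars) : Prop where
  mono : Monotone u
  le_lcs : ∀ p, threshold A (u p) ≤ prefixLcs I.offline s p σ.r
  lcs_le : ∀ p ≤ I.len, (prefixLcs I.offline s p σ.r : ℝ) ≤ C * threshold A (u p)
  growth : σ.A = A
  P : σ.P = firstHit u I.len
  Q : σ.Q = fun _ => 0
  e : σ.e = 0
  k : σ.k = 0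
  d : σ.d = 0
  j : σ.j = 0
  tg : σ.tg = threshold A (u I.len)

/-- The new function is the level of the last column of the table. The table inherits the factor `C`
from its first column, and rounding to levels contributes the single new factor `c`. -/
theorem exec_processBlock (hI : Ambient I N w W) {σ : Vars} {s u : ℕ → ℕ} {A T : ℕ} {c C : ℝ}
    (hs : ∀ i, s i < 2 ^ w) (hN : level A I.len < N) (hTN : T < N)
    (hc : ∀ x ≤ I.len, ((x / A : ℕ) : ℝ) ≤ (c - 1) * x) (hC : 1 ≤ C)
    (hT : T = min (I.len / σ.q + 1) (I.len - σ.r)) (hr : σ.r ≤ I.len)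
    (h : BlockState I s A C u σ) :
    ∃ u' σ', BlockState I s A (C * c) u' σ' ∧ σ'.q = σ.q ∧ σ'.r = σ.r + T ∧
      Exec I N w W processBlock σ (streamFrom s I.len σ.r) σ' (streamFrom s I.len σ'.r) := by
  have hlen := hI.len_lt
  have hpos := Nat.two_pow_pos w
  have hle : ∀ p, threshold A (u p) ≤ p := fun p => (h.le_lcs p).trans (prefixLcs_le _ _ _ _)
  have hu0 : u 0 = 0 := Nat.le_zero.1 (threshold_strictMono.le_apply.trans (hle 0))
  set f : ℕ → ℕ := fun p => threshold A (u p) with hf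
  set b : ℕ → ℕ := fun k => s (σ.r + k) with hb
  set u' : ℕ → ℕ := fun p => level A (alignTable I.offline b f p T) with hu'
  have hfmono : Monotone f := fun _ _ h' => threshold_strictMono.monotone (h.mono h')
  have hmono : Monotone u' := fun _ _ h' => level_mono (alignTable_mono hfmono T h')
  have hD := alignTable_le (a := I.offline) (b := b) hle
  have hu'n : u' I.len ≤ level A I.len := level_mono (hD _ _)
  -- The last column dominates the first, so levels once reached stay reached. Hence copying the
  -- entries `1, …, u' I.len` leaves no stale position in `P`.
  have huu' : u I.len ≤ u' I.len := le_level_iff.2 (le_alignTable (f := f) (by simp [hf, hu0]) _ _)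
  let σ₁ : Vars := { σ with
    m := T
    r := σ.r + T
    b := fun k => if k < T then s (σ.r + k) else σ.b k
    L := fun k => if k ≤ T then 0 else Function.update σ.L 0 0 k
    p := 0
    i := 0
    tf := 0
    tg := 0 }
  let σ₂ : Vars := sweepState A T I.offline b u σ₁ I.len
  have hσ₂j : σ₂.j = u' I.len := rfl
  have hσ₂Q : σ₂.Q = firstHit u' I.len := rfl
  refine ⟨u', { σ₂ with
    j := 0
    P := fun i => if 0 < i ∧ i ≤ σ₂.j then σ₂.Q i else σ₂.P i
    Q := fun i => if 0 < i ∧ i ≤ σ₂.j then 0 else σ₂.Q i }, ?_, rfl, rfl, ?_⟩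
  · refine ⟨hmono, fun p => ?_, fun p hp => ?_, h.growth, ?_, ?_, h.e, h.k, h.d, rfl, rfl⟩
    · exact (threshold_level_le _).trans (alignTable_le_prefixLcs h.le_lcs p T)
    · have h₁ := prefixLcs_le_mul_alignTable hC h.lcs_le hp T
      have h₂ := le_mul_threshold_level ((hD p T).trans hp) hc
      calc (prefixLcs I.offline s p (σ.r + T) : ℝ) ≤ C * alignTable I.offline b f p T := h₁
        _ ≤ C * (c * threshold A (u' p)) := by gcongr
        _ = C * c * threshold A (u' p) := by ring
    · funext i
      change (if 0 < i ∧ i ≤ u' I.len then firstHit u' I.len i else σ.P i) = _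
      rw [h.P]
      split_ifs with hi
      · rfl
      · rcases Nat.eq_zero_or_pos i with rfl | hi0
        · rw [firstHit_eq_zero_of_le (Nat.zero_le _), firstHit_eq_zero_of_le (Nat.zero_le _)]
        · rw [firstHit_eq_zero_of_lt h.mono (by omega), firstHit_eq_zero_of_lt hmono (by omega)]
    · funext i
      change (if 0 < i ∧ i ≤ u' I.len then 0 else firstHit u' I.len i) = _
      split_ifs with hi
      · rfl
      · rcases Nat.eq_zero_or_pos i with rfl | hi0
        · exact firstHit_eq_zero_of_le (Nat.zero_le _)
        · exact firstHit_eq_zero_of_lt hmono (by omega)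
  · have hsweep : Exec I N w W sweep σ₁ (streamFrom s I.len (σ.r + T)) σ₂
        (streamFrom s I.len (σ.r + T)) :=
      exec_sweep hI hN hTN (by omega) h.mono hle h.growth rfl h.e h.k h.d
        (fun k hk => if_pos hk) h.P rfl rfl rfl h.j rfl (fun k hk => if_pos hk) h.Q
    have hcopy := exec_copyBack (W := W) hI (σ := σ₂) (l := streamFrom s I.len (σ.r + T))
      (by omega) fun i => by
        rw [hσ₂Q]
        exact (firstHit_le _ _ _).trans_lt hlen
    exact (Exec.set hI rfl rfl (v := 0) (fun M hM => rfl)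
        fun M hM => hM.set_m hI.pos hpos).seq <|
      (Exec.setCell hI rfl rfl (k := 0) (v := 0) (fun M hM => rfl) (fun M hM => rfl)
        fun M hM => hM.set_L hI.pos hpos).seq <|
      (exec_fetch (σ := { σ with m := 0, L := Function.update σ.L 0 0 }) hI hs hT hTN hr
        rfl (Function.update_self 0 0 σ.L)).seq <|
      (Exec.set hI rfl rfl (v := 0) (fun M hM => rfl)
        fun M hM => hM.set_p hI.pos hpos).seq <|
      (Exec.set hI rfl rfl (v := 0) (fun M hM => rfl)
        fun M hM => hM.set_i hI.pos hpos).seq <|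
      (Exec.set hI rfl rfl (v := 0) (fun M hM => rfl)
        fun M hM => hM.set_tf hI.pos hpos).seq <|
      (Exec.set hI rfl rfl (v := 0) (fun M hM => rfl)
        fun M hM => hM.set_tg hI.pos hpos).seq <|
      hsweep.seq hcopy

end Block

/-! ### The whole run -/

section Program

variable {I : Input} {N w W : ℕ}

theorem exec_computeSqrt (hI : Ambient I N w W) (l : List ℕ) :
    Exec I N w W computeSqrt {} l { q := Nat.sqrt I.len } l := by
  have hlen := hI.len_lt
  have hsq := Nat.sqrt_le_self I.len
  refine Exec.loop (fun x => { q := x }) (fun _ => l) (Nat.sqrt I.len) rfl rfl rfl rfl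
    (fits_of_accuracyFree hI rfl) ?_ ?_ ?_
  · intro x hx M hM
    have := Nat.le_sqrt.1 (Nat.succ_le_of_lt hx)
    simp only [Expr.eval, Expr.eval_succ, Expr.eval_var, hM.q]
    rw [if_pos (Nat.lt_succ_of_le this)]
    exact one_ne_zero
  · intro M hM
    have := Nat.succ_le_succ_sqrt I.len
    simp only [Expr.eval, Expr.eval_succ, Expr.eval_var, hM.q]
    exact if_neg (by simpa using this)
  · intro x hx
    exact Exec.set hI rfl rfl (v := x + 1)
      (fun M hM => by simp only [Expr.eval_succ, Expr.eval_var, hM.q])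
      fun M hM => hM.set_q hI.pos (by omega)

/-- The fitting hypotheses are needed only for length at least two. For length one the logarithm in
the memory bound of part 1 vanishes, which leaves no room for reading the accuracy parameter. The
cap at `I.len + 1` keeps `A` within a word. -/
theorem exec_computeGrowth (hI : Ambient I N w W) (hlen : I.len + 1 < 2 ^ w) {den : Expr}
    {D : ℕ} {σ : Vars} (l : List ℕ)
    (hfit : 2 ≤ I.len → Fits I w W den ∧ Fits I w W (.lt den (.succ .len)))
    (hden : Evals I N w den σ D) :
    Exec I N w W (computeGrowth den) σ l
      { σ with A := if I.len < 2 then 2 else min D (I.len + 1) } l := by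
  have h5 : 2 ^ 5 ≤ 2 ^ w := Nat.pow_le_pow_right (by norm_num) hI.five_le
  have hset3 : Fits I w W (.const 3) := fits_of_accuracyFree hI rfl
  by_cases hn : I.len < 2
  · rw [if_pos hn]
    refine Exec.ite_pos (fits_of_accuracyFree hI rfl) (fun M hM => ?_) <|
      Exec.set hI rfl rfl (v := 2) (fun M hM => rfl) fun M hM => hM.set_A hI.pos (by omega)
    simp only [Expr.eval, hn, if_true]
    exact one_ne_zero
  · rw [if_neg hn]
    obtain ⟨hf₁, hf₂⟩ := hfit (by omega)
    refine Exec.ite_neg (fits_of_accuracyFree hI rfl)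
      (fun M hM => by simp only [Expr.eval, hn, if_false]) ?_
    by_cases hD : D < I.len + 1
    · rw [min_eq_left hD.le]
      refine Exec.ite_pos hf₂ (fun M hM => ?_) <|
        Exec.store hset3 hf₁ (addr := 3) (fun M hM => rfl) hden
          fun M hM => hM.set_A hI.pos (by omega)
      simp only [Expr.eval, Expr.eval_succ, hden M hM, hD, if_true]
      exact one_ne_zero
    · rw [min_eq_right (by omega)]
      refine Exec.ite_neg hf₂ (fun M hM => ?_) <|
        Exec.set hI rfl rfl (v := I.len + 1) (fun M hM => rfl)
          fun M hM => hM.set_A hI.pos hlen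
      simp only [Expr.eval, Expr.eval_succ, hden M hM, hD, if_false]

/-- With `q = Nat.sqrt n`, blocks of length `⌊n/q⌋ + 1` exhaust the string after at most `q` rounds,
so at most `q` roundings occur. -/
theorem exec_blocks (hI : Ambient I N w W) {s : ℕ → ℕ} {A : ℕ} {c : ℝ}
    (hs : ∀ i, s i < 2 ^ w) (hn : 1 ≤ I.len) (hN : level A I.len < N)
    (hTN : I.len / Nat.sqrt I.len + 1 < N) (hc1 : 1 ≤ c)
    (hc : ∀ x ≤ I.len, ((x / A : ℕ) : ℝ) ≤ (c - 1) * x) :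
    ∃ σ' l', Exec I N w W (.loop (.lt (.var 4) .len) processBlock)
        { q := Nat.sqrt I.len, A := A } (streamFrom s I.len 0) σ' l' ∧
      σ'.tg ≤ prefixLcs I.offline s I.len I.len ∧
      (prefixLcs I.offline s I.len I.len : ℝ) ≤ c ^ Nat.sqrt I.len * σ'.tg := by
  set q := Nat.sqrt I.len with hq
  have hq0 : 0 < q := Nat.sqrt_pos.2 hn
  have hqn : I.len < (I.len / q + 1) * q := (Nat.div_lt_iff_lt_mul hq0).1 (Nat.lt_succ_self _)
  refine Exists.elim (Exec.loop_of_invariant (I := I) (N := N) (w := w) (W := W)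
    (c := .lt (.var 4) .len) (p := processBlock)
    -- The formula for `r` is demanded only before the end, since the last block may be shorter.
    (fun σ l => ∃ u m, BlockState I s A (c ^ m) u σ ∧ σ.q = q ∧ σ.r ≤ I.len ∧ m ≤ q ∧
      (σ.r < I.len → σ.r = (I.len / q + 1) * m) ∧ l = streamFrom s I.len σ.r)
    (fun σ => σ.r = I.len) (fun σ => I.len - σ.r) (fits_of_accuracyFree hI rfl) ?_
    { q := q, A := A } (streamFrom s I.len 0) ?_) ?_
  rotate_left 2
  · rintro σ' ⟨l', ⟨u, m, hB, -, -, hmq, -, -⟩, hdone, hex⟩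
    refine ⟨σ', l', hex, ?_, ?_⟩
    · rw [hB.tg]
      have := hB.le_lcs I.len
      rwa [hdone] at this
    · rw [hB.tg]
      have := hB.lcs_le I.len le_rfl
      rw [hdone] at this
      refine this.trans ?_
      gcongr
  · rintro σ l ⟨u, m, hB, hσq, hr, hmq, hrm, rfl⟩
    rcases hr.eq_or_lt with hr' | hr'
    · refine Or.inl ⟨hr', fun M hM => ?_⟩
      simp only [Expr.eval, Expr.eval_var, hM.r, hr', lt_irrefl, if_false]
    · refine Or.inr ⟨fun M hM => ?_, ?_⟩
      · simp only [Expr.eval, Expr.eval_var, hM.r, hr', if_true]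
        exact one_ne_zero
      · obtain ⟨T, hT⟩ : ∃ T, T = min (I.len / σ.q + 1) (I.len - σ.r) := ⟨_, rfl⟩
        obtain ⟨u', σ', hB', hq', hr'', hex⟩ := exec_processBlock hI hs hN
          (show T < N by rw [hσq] at hT; omega) hc (one_le_pow₀ hc1) hT hr hB
        rw [hσq] at hT
        -- After `q` full blocks the position would exceed `n`, by `hqn`.
        have hm : m < q := by
          by_contra hcon
          have h₁ := hrm hr'
          have h₂ := Nat.mul_le_mul_left (I.len / q + 1) (not_lt.1 hcon)
          omega
        refine ⟨σ', _, ⟨u', m + 1, by rwa [pow_succ], hq'.trans hσq, by omega, hm, fun hlt => ?_,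
          rfl⟩, ?_, hex⟩
        · rw [hr'', mul_add, mul_one, ← hrm hr']
          omega
        · have := Nat.succ_pos (I.len / q)
          omega
  · refine ⟨fun _ => 0, 0, ⟨fun _ _ _ => le_rfl, fun p => Nat.zero_le _, fun p _ => ?_, rfl, ?_,
      rfl, rfl, rfl, rfl, rfl, rfl⟩, rfl, Nat.zero_le _, Nat.zero_le _, fun _ => rfl, rfl⟩
    · simp [prefixLcs_zero_right]
    · funext i
      rcases Nat.eq_zero_or_pos i with rfl | hi
      · exact (firstHit_eq_zero_of_le le_rfl).symm
      · exact (firstHit_eq_zero_of_lt (fun _ _ _ => le_rfl) hi).symm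

theorem rep_zero (N w : ℕ) : Rep N w {} 0 := by
  refine ⟨fun r => by simp, fun r h => absurd rfl h, ?_, ?_, ?_, ?_, ?_, ?_, ?_, ?_, ?_, ?_, ?_, ?_,
    fun x => ?_, fun x => ?_, fun x => ?_, fun x => ?_⟩ <;> rfl

end Program

/-! ### Parameters of a run and the approximation factor -/

/-- The number of bits of an entry of the working memory. -/
def wordSize (n σ : ℕ) : ℕ := Nat.size (n + 1 + σ) + 5

/-- The number of bits that are charged for the value of an expression. -/
def scratchSize (n σ a : ℕ) : ℕ := wordSize n σ + if n < 2 then 0 else Nat.size a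

/-- The number of entries of each array. -/
def arraySize (n A : ℕ) : ℕ := n / Nat.sqrt n + 1 + level A n + 1

/-- The growth parameter of the thresholds. -/
def growth (n D : ℕ) : ℕ := if n < 2 then 2 else min D (n + 1)

/-- If the growth parameter is `n + 1`, which includes `n = 1`, the quotients `x / (n + 1)` vanish,
every value up to `n` is a threshold, and `c = 1`. Otherwise the parameter is `D` and `c = 1 + 1/D`,
with `(1 - 1/D) * (1 + 1/D) ≤ 1`. -/
theorem exists_growth_factor {n D : ℕ} (hn : 1 ≤ n) (hD : 1 ≤ D) :
    ∃ c : ℝ, 1 ≤ c ∧ (1 - 1 / (D : ℝ)) * c ≤ 1 ∧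
      ∀ x ≤ n, ((x / growth n D : ℕ) : ℝ) ≤ (c - 1) * x := by
  have hD' : (1 : ℝ) ≤ D := by exact_mod_cast hD
  by_cases h : growth n D = n + 1
  · refine ⟨1, le_rfl, ?_, fun x hx => ?_⟩
    · have : 0 ≤ 1 / (D : ℝ) := by positivity
      linarith
    · rw [h, Nat.div_eq_of_lt (by omega)]
      simp
  · have hg : growth n D = D := by
      unfold growth at h ⊢
      split_ifs at h ⊢ with hn2 <;> omega
    have hpos : (0 : ℝ) < D := by linarith
    refine ⟨1 + 1 / D, by simp, ?_, fun x _ => ?_⟩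
    · have : (1 - 1 / (D : ℝ)) * (1 + 1 / D) = 1 - (1 / D) ^ 2 := by ring
      rw [this]
      nlinarith [sq_nonneg (1 / (D : ℝ))]
    · rw [hg]
      refine Nat.cast_div_le.trans (le_of_eq ?_)
      ring

/-- Both parts run the same program up to the expression `den`; its value `D` is taken after the
square root has been stored, so `den` may refer to it. -/
theorem lcsProgram_outputs {den : Expr} {n σ D : ℕ} {ε : ℝ} (hn : 1 ≤ n) (hD : 1 ≤ D)
    (hden : (den.tame && (Expr.lt den (.succ .len)).tame) = true) (t s : Fin n → Fin σ)
    (hdenv : ∀ N w, Evals (input t ε) N w den { q := Nat.sqrt n } D) :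
    ∃ v, Outputs (lcsProgram den) t ε s
        (budget (arraySize n (growth n D)) (wordSize n σ) (scratchSize n σ ⌈1 / ε⌉₊)) v ∧
      (1 - 1 / (D : ℝ)) ^ Nat.sqrt n * (lcsLength (List.ofFn t) (List.ofFn s) : ℝ) ≤ (v : ℝ) ∧
      v ≤ lcsLength (List.ofFn t) (List.ofFn s) := by
  obtain ⟨c, hc1, hDc, hc⟩ := exists_growth_factor hn hD
  set A := growth n D with hA
  set N := arraySize n A with hN
  set w := wordSize n σ with hw
  set W := scratchSize n σ ⌈1 / ε⌉₊ with hW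
  have hlt : n + 1 + σ < 2 ^ w :=
    (Nat.lt_size_self _).trans_le (Nat.pow_le_pow_right (by norm_num) (Nat.le_add_right _ 5))
  have hoff : ∀ i, (input t ε).offline i < 2 ^ w := fun i => by
    simp only [input]
    split_ifs with h
    · have := (t ⟨i, h⟩).isLt
      omega
    · omega
  have hI : Ambient (input t ε) N w W :=
    ⟨Nat.succ_pos _, Nat.le_add_left _ _, by simp only [input]; omega, hoff,
      Nat.le_add_right _ _⟩
  let s' : ℕ → ℕ := fun i => if h : i < n then (s ⟨i, h⟩ : ℕ) else 0
  have hs' : ∀ i, s' i < 2 ^ w := fun i => by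
    simp only [s']
    split_ifs with h
    · have := (s ⟨i, h⟩).isLt
      omega
    · omega
  obtain ⟨τ, l, hex, hle, hge⟩ := exec_blocks hI (A := A) hs' hn
    (Nat.lt_succ_of_le (Nat.le_add_left _ _)) (by simp only [hN, arraySize, input]; omega)
    hc1 hc
  have hacc : 2 ≤ n → (input t ε).accuracy < 2 ^ W := fun h2 => by
    refine (Nat.lt_size_self ⌈1 / ε⌉₊).trans_le (Nat.pow_le_pow_right (by norm_num) ?_)
    simp only [hW, scratchSize, if_neg (not_lt.2 h2)]
    exact Nat.le_add_left _ _
  simp only [Bool.and_eq_true] at hden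
  have hprog : Exec (input t ε) N w W (lcsProgram den) {} (streamFrom s' n 0) τ l :=
    (exec_computeSqrt hI _).seq <|
      (exec_computeGrowth hI (by simp only [input]; omega) _ (fun h2 =>
        ⟨fits_of_accuracy_lt hI hden.1 (hacc h2), fits_of_accuracy_lt hI hden.2 (hacc h2)⟩)
        (hdenv N w)).seq hex
  obtain ⟨M, hM, hruns⟩ := hprog 0 (rep_zero N w)
  have hstream : streamFrom s' n 0 = List.ofFn fun i => (s i : ℕ) := by
    apply List.ext_getElem
    · simp [streamFrom]
    · intro i h₁ h₂
      have hi : i < n := by simpa using h₂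
      simp [streamFrom, s', hi]
  have hlcs : lcsLength (List.ofFn t) (List.ofFn s) = prefixLcs (input t ε).offline s' n n := by
    have := lcsLength_take_ofFn t s (input t ε).offline s' (fun i => by simp [input])
      (fun i => by simp [s']) le_rfl le_rfl
    simpa only [List.take_of_length_le, List.length_ofFn, le_refl] using this
  refine ⟨τ.tg, ⟨⟨M, l⟩, ?_, hM.tg⟩, ?_, ?_⟩
  · rw [hstream] at hruns
    exact hruns
  · rw [hlcs]
    have hD' : (1 : ℝ) ≤ D := by exact_mod_cast hD
    have h0 : 0 ≤ 1 - 1 / (D : ℝ) := sub_nonneg.2 ((div_le_one (by linarith)).2 hD')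
    calc (1 - 1 / (D : ℝ)) ^ Nat.sqrt n * (prefixLcs (input t ε).offline s' n n : ℝ)
        ≤ (1 - 1 / (D : ℝ)) ^ Nat.sqrt n * (c ^ Nat.sqrt n * τ.tg) := by
          gcongr
          exact hge
      _ = ((1 - 1 / (D : ℝ)) * c) ^ Nat.sqrt n * τ.tg := by rw [mul_pow]; ring
      _ ≤ 1 * τ.tg := by
          gcongr
          exact pow_le_one₀ (mul_nonneg h0 (by linarith)) hDc
      _ = τ.tg := one_mul _
  · rw [hlcs]
    exact hle

/-! ### The memory bound -/

theorem size_le_log {x : ℕ} (hx : 1 ≤ x) : (Nat.size x : ℝ) ≤ 1 + 2 * Real.log x := by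
  have hpos : 0 < Nat.size x := Nat.size_pos.2 hx
  obtain ⟨k, hk⟩ := Nat.exists_eq_succ_of_ne_zero hpos.ne'
  have h₁ : 2 ^ k ≤ x := Nat.lt_size.1 (by omega)
  have h₂ : (k : ℝ) * Real.log 2 ≤ Real.log x := by
    rw [← Real.log_pow]
    exact Real.log_le_log (by positivity) (by exact_mod_cast h₁)
  have h₃ := Real.log_two_gt_d9
  have h₄ : (0 : ℝ) ≤ k := Nat.cast_nonneg k
  rw [hk]
  push_cast
  nlinarith

/-- With `q = Nat.sqrt n` one has `n ≤ q ^ 2 + 2 * q`. -/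
theorem div_sqrt_le (n : ℕ) : n / Nat.sqrt n ≤ Nat.sqrt n + 2 := by
  rcases Nat.eq_zero_or_pos (Nat.sqrt n) with h | h
  · rw [h]; simp
  · refine Nat.lt_succ_iff.1 ((Nat.div_lt_iff_lt_mul h).2 ?_)
    have := Nat.sqrt_le_add n
    nlinarith

theorem arraySize_le {n D : ℕ} (hn : 1 ≤ n) (hD : 1 ≤ D) :
    (arraySize n (growth n D) : ℝ) ≤ 6 * Real.sqrt n + 2 * (D * Real.log n) := by
  have hsqrt : (1 : ℝ) ≤ Real.sqrt n := Real.one_le_sqrt.2 (by exact_mod_cast hn)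
  have hdiv : ((n / Nat.sqrt n : ℕ) : ℝ) ≤ Real.sqrt n + 2 := by
    have h : ((n / Nat.sqrt n : ℕ) : ℝ) ≤ Nat.sqrt n + 2 := by exact_mod_cast div_sqrt_le n
    linarith [Real.nat_sqrt_le_real_sqrt (a := n)]
  have hlog : 0 ≤ Real.log n := Real.log_nonneg (by exact_mod_cast hn)
  have hlevel : (level (growth n D) n : ℝ) ≤ 1 + 2 * (D * Real.log n) := by
    have hg : 0 < growth n D := by unfold growth; split_ifs <;> omega
    refine (level_le_log hg hn).trans ?_
    -- For `n = 1` the growth parameter `2` may exceed `D`, but then `log n = 0`.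
    rcases hn.eq_or_lt with rfl | hn2
    · simp
    · have : (growth n D : ℝ) ≤ D := by
        have : growth n D ≤ D := by
          rw [growth, if_neg (by omega)]
          exact min_le_left _ _
        exact_mod_cast this
      have := mul_le_mul_of_nonneg_right this hlog
      linarith
  rw [arraySize]
  push_cast
  linarith

/-- `F` stands for the claimed bound of either part. It has to dominate `√n`, the number of
thresholds up to a logarithm, and, for `n ≥ 2`, the accuracy parameter. -/
theorem budget_le {n σ D a : ℕ} {F : ℝ} (hn : 1 ≤ n) (hσ : 1 ≤ σ) (hD : 1 ≤ D)
    (hF : Real.sqrt n ≤ F) (hDF : D * Real.log n ≤ 4 * (F * (1 + Real.log n)))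
    (haF : 2 ≤ n → (a : ℝ) ≤ 4 * F) :
    (budget (arraySize n (growth n D)) (wordSize n σ) (scratchSize n σ a) : ℝ) ≤
      400000 * F * (1 + Real.log n) ^ 2 * (1 + Real.log σ) := by
  have hn' : (1 : ℝ) ≤ n := by exact_mod_cast hn
  have hσ' : (1 : ℝ) ≤ σ := by exact_mod_cast hσ
  have hlogn : 0 ≤ Real.log n := Real.log_nonneg hn'
  have hlogσ : 0 ≤ Real.log σ := Real.log_nonneg hσ'
  have hF1 : 1 ≤ F := (Real.one_le_sqrt.2 hn').trans hF
  have hw : (wordSize n σ : ℝ) ≤ 10 + 2 * Real.log n + 2 * Real.log σ := by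
    -- A product is needed so that its logarithm splits into `log n` and `log σ`.
    have h₁ : n + 1 + σ ≤ 3 * (n * σ) := by nlinarith
    have h₂ : Nat.size (n + 1 + σ) ≤ Nat.size (3 * (n * σ)) := Nat.size_le_size h₁
    have h₃ : (Nat.size (n + 1 + σ) : ℝ) ≤ Nat.size (3 * (n * σ)) := by exact_mod_cast h₂
    have h₄ := size_le_log (x := 3 * (n * σ)) (by nlinarith)
    have h₅ : Real.log (3 * (n * σ) : ℕ) = Real.log 3 + (Real.log n + Real.log σ) := by
      push_cast
      rw [Real.log_mul (by norm_num) (by positivity), Real.log_mul (by positivity) (by positivity)]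
    have h₆ : Real.log 3 ≤ 3 - 1 := Real.log_le_sub_one_of_pos (by norm_num)
    rw [h₅] at h₄
    rw [wordSize]
    push_cast
    linarith
  have hN : (arraySize n (growth n D) : ℝ) ≤ 14 * (F * (1 + Real.log n)) := by
    have := arraySize_le hn hD
    nlinarith
  have hsize : (Nat.size (16 * arraySize n (growth n D)) : ℝ) ≤ 13 + 2 * Real.log n := by
    have h₁ : 16 * arraySize n (growth n D) ≤ 2 ^ 6 * n := by
      have := level_le (A := growth n D) n
      have := Nat.div_le_self n (Nat.sqrt n)
      rw [arraySize]
      omega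
    have h₂ : (Nat.size (16 * arraySize n (growth n D)) : ℝ) ≤ Nat.size (2 ^ 6 * n) := by
      exact_mod_cast Nat.size_le_size h₁
    have h₃ := size_le_log (x := 2 ^ 6 * n) (by omega)
    have h₅ : Real.log (2 ^ 6 * n : ℕ) = 6 * Real.log 2 + Real.log n := by
      push_cast
      rw [Real.log_mul (by norm_num) (by positivity), show (64 : ℝ) = 2 ^ 6 by norm_num,
        Real.log_pow]
      norm_num
    have h₆ : Real.log 2 ≤ 2 - 1 := Real.log_le_sub_one_of_pos (by norm_num)
    rw [h₅] at h₃
    linarith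
  have hW : (scratchSize n σ a : ℝ) ≤ 10 + 2 * Real.log n + 2 * Real.log σ + 4 * F := by
    rw [scratchSize]
    split_ifs with h2
    · push_cast
      linarith
    -- Bounding the bit length of `a` by `a` itself suffices, because `a ≤ 4 * F`.
    · have h₁ : Nat.size a ≤ a := Nat.size_le.2 Nat.lt_two_pow_self
      have h₂ : (Nat.size a : ℝ) ≤ a := by exact_mod_cast h₁
      have := haF (by omega)
      push_cast
      linarith
  set x := 1 + Real.log n with hx
  set y := 1 + Real.log σ with hy
  have hx1 : 1 ≤ x := by linarith
  have hy1 : 1 ≤ y := by linarith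
  have hxy : x + y ≤ 2 * (x * y) := by nlinarith
  have h1 : (Nat.size (16 * arraySize n (growth n D)) : ℝ) + wordSize n σ ≤ 31 * (x * y) := by
    nlinarith
  have h2 : (scratchSize n σ a : ℝ) ≤ 14 * (F * (x * y)) := by
    have hxy1 : 1 ≤ x * y := one_le_mul_of_one_le_of_one_le hx1 hy1
    nlinarith
  have h3 : F * (x * y) ≤ F * x ^ 2 * y := by
    have : x * y ≤ x ^ 2 * y := by nlinarith
    nlinarith
  rw [budget]
  push_cast
  calc 16 * (arraySize n (growth n D) : ℝ) *
        ((Nat.size (16 * arraySize n (growth n D)) : ℝ) + wordSize n σ) +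
          20000 * (scratchSize n σ a : ℝ)
      ≤ 16 * (14 * (F * x)) * (31 * (x * y)) + 20000 * (14 * (F * (x * y))) := by gcongr
    _ = 6944 * (F * x ^ 2 * y) + 280000 * (F * (x * y)) := by ring
    _ ≤ 400000 * F * x ^ 2 * y := by nlinarith [mul_pos (mul_pos (lt_of_lt_of_le one_pos hF1)
          (pow_pos (lt_of_lt_of_le one_pos hx1) 2)) (lt_of_lt_of_le one_pos hy1)]

/-! ### The two choices of the growth parameter -/

theorem ceil_inv_le {ε : ℝ} (h0 : 0 < ε) (h1 : ε < 1) : (⌈1 / ε⌉₊ : ℝ) ≤ 2 / ε := by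
  have h₁ := (Nat.ceil_lt_add_one (a := 1 / ε) (by positivity)).le
  have h₂ : 1 ≤ 1 / ε := (one_le_div h0).2 h1.le
  calc (⌈1 / ε⌉₊ : ℝ) ≤ 1 / ε + 1 := h₁
    _ ≤ 1 / ε + 1 / ε := by linarith
    _ = 2 / ε := by ring

theorem one_sub_le_one_sub_inv_ceil {ε : ℝ} (h0 : 0 < ε) : 1 - ε ≤ 1 - 1 / (⌈1 / ε⌉₊ : ℝ) := by
  have : 1 / (⌈1 / ε⌉₊ : ℝ) ≤ ε := by
    rw [one_div_le (Nat.cast_pos.2 (Nat.ceil_pos.2 (by positivity))) h0]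
    exact Nat.le_ceil _
  linarith

/-- Since `log (1 + ε) ≤ ε`; hence the bound of part 1 pays for `O(log n / ε)` thresholds. -/
theorem log_div_le_logb {n : ℕ} {ε : ℝ} (hn : 1 ≤ n) (h0 : 0 < ε) :
    Real.log n / ε ≤ Real.logb (1 + ε) n := by
  have hpos : 0 < Real.log (1 + ε) := Real.log_pos (by linarith)
  have hle : Real.log (1 + ε) ≤ ε := by
    have := Real.log_le_sub_one_of_pos (show 0 < 1 + ε by linarith)
    linarith
  exact div_le_div_of_nonneg_left (Real.log_nonneg (by exact_mod_cast hn)) hpos hle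

theorem approximates_pow : ApproximatesLCS (lcsProgram .accuracy)
    (fun n ε => (1 - ε) ^ Real.sqrt n) (fun n ε => Real.sqrt n + Real.logb (1 + ε) n) := by
  refine ⟨400000, 2, fun n σ ε hn h0 h1 t s => ?_⟩
  set a := ⌈1 / ε⌉₊ with ha
  have hn' : (1 : ℝ) ≤ n := by exact_mod_cast hn
  have hlogn : 0 ≤ Real.log n := Real.log_nonneg hn'
  have ha1 : 1 ≤ a := Nat.ceil_pos.2 (by positivity)
  have hσ : 1 ≤ σ := (Nat.zero_le _).trans_lt (t ⟨0, hn⟩).isLt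
  have hlogb := log_div_le_logb hn h0
  have hlogb0 : 0 ≤ Real.log n / ε := by positivity
  have hsqrt := Real.sqrt_nonneg (n : ℝ)
  have haε : (a : ℝ) ≤ 2 / ε := ceil_inv_le h0 h1
  obtain ⟨v, hout, hlow, hup⟩ := lcsProgram_outputs (den := .accuracy) (ε := ε) hn ha1 rfl t s
    (fun N w M hM => rfl)
  refine ⟨_, v, hout, budget_le hn hσ ha1 (by linarith) ?_ fun h2 => ?_, le_trans ?_ hlow, hup⟩
  · have h₁ : a * Real.log n ≤ 2 * (Real.log n / ε) := by
      calc a * Real.log n ≤ 2 / ε * Real.log n := mul_le_mul_of_nonneg_right haε hlogn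
        _ = 2 * (Real.log n / ε) := by ring
    nlinarith [mul_nonneg (show 0 ≤ Real.sqrt n + Real.logb (1 + ε) n by linarith) hlogn]
  -- For `n ≥ 2` the term `logb (1 + ε) n` is at least of order `1/ε` and so pays for the accuracy
  -- parameter.
  · have h₁ : 1 / 2 ≤ Real.log n := by
      have := Real.log_le_log (by norm_num) (show (2 : ℝ) ≤ n by exact_mod_cast h2)
      linarith [Real.log_two_gt_d9]
    have h₂ : 2 / ε ≤ 4 * (Real.log n / ε) := by
      rw [← mul_div_assoc]
      exact div_le_div_of_nonneg_right (by linarith) h0.le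
    linarith
  · have hq : (Nat.sqrt n : ℝ) ≤ Real.sqrt n := Real.nat_sqrt_le_real_sqrt
    refine mul_le_mul_of_nonneg_right ?_ (Nat.cast_nonneg _)
    -- The base lies in `(0, 1)`, so lowering the exponent to the integer root increases the power.
    calc (1 - ε) ^ Real.sqrt n ≤ (1 - ε) ^ (Nat.sqrt n : ℝ) :=
          Real.rpow_le_rpow_of_exponent_ge (by linarith) (by linarith) hq
      _ = (1 - ε) ^ Nat.sqrt n := Real.rpow_natCast _ _
      _ ≤ (1 - 1 / (a : ℝ)) ^ Nat.sqrt n :=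
          pow_le_pow_left₀ (by linarith) (one_sub_le_one_sub_inv_ceil h0) _

/-- With `a = ⌈1/ε⌉`, `q = Nat.sqrt n` and `D = a * q`, Bernoulli gives `(1 - 1/D) ^ q ≥ 1 - q/D = 1
- 1/a ≥ 1 - ε`, while `D ≤ 2 * √n / ε`. -/
theorem approximates_one_sub : ApproximatesLCS (lcsProgram (.mul .accuracy (.var 1)))
    (fun _ ε => 1 - ε) (fun n ε => Real.sqrt n / ε) := by
  refine ⟨400000, 2, fun n σ ε hn h0 h1 t s => ?_⟩
  set a := ⌈1 / ε⌉₊ with ha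
  have hn' : (1 : ℝ) ≤ n := by exact_mod_cast hn
  have hlogn : 0 ≤ Real.log n := Real.log_nonneg hn'
  have ha1 : 1 ≤ a := Nat.ceil_pos.2 (by positivity)
  have hq1 : 1 ≤ Nat.sqrt n := Nat.sqrt_pos.2 hn
  have hD1 : 1 ≤ a * Nat.sqrt n := Nat.mul_pos ha1 hq1
  have hσ : 1 ≤ σ := (Nat.zero_le _).trans_lt (t ⟨0, hn⟩).isLt
  have hsqrt : 1 ≤ Real.sqrt n := Real.one_le_sqrt.2 hn'
  have haε : (a : ℝ) ≤ 2 / ε := ceil_inv_le h0 h1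
  have hq : (Nat.sqrt n : ℝ) ≤ Real.sqrt n := Real.nat_sqrt_le_real_sqrt
  obtain ⟨v, hout, hlow, hup⟩ := lcsProgram_outputs (den := .mul .accuracy (.var 1)) (ε := ε) hn
    hD1 rfl t s (fun N w M hM => by simp only [Expr.eval, Expr.eval_var, hM.q, input, ha])
  refine ⟨_, v, hout, budget_le hn hσ hD1 ?_ ?_ fun h2 => ?_, le_trans ?_ hlow, hup⟩
  · exact le_div_self (by linarith) h0 h1.le
  · have h₁ : ((a * Nat.sqrt n : ℕ) : ℝ) ≤ 2 * (Real.sqrt n / ε) := by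
      push_cast
      calc (a : ℝ) * Nat.sqrt n ≤ 2 / ε * Real.sqrt n := by gcongr
        _ = 2 * (Real.sqrt n / ε) := by ring
    have h₂ : 0 ≤ Real.sqrt n / ε := by positivity
    have h₃ := mul_le_mul_of_nonneg_right h₁ hlogn
    nlinarith [mul_nonneg h₂ hlogn]
  · have h₂ : 1 / ε ≤ Real.sqrt n / ε := div_le_div_of_nonneg_right hsqrt h0.le
    have h₃ : 2 / ε = 2 * (1 / ε) := by ring
    have h₄ : 0 ≤ 1 / ε := by positivity
    linarith
  · refine mul_le_mul_of_nonneg_right ?_ (Nat.cast_nonneg _)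
    have hq0 : (0 : ℝ) < Nat.sqrt n := by exact_mod_cast hq1
    have ha0 : (1 : ℝ) ≤ a := by exact_mod_cast ha1
    have hD0 : (1 : ℝ) ≤ (a * Nat.sqrt n : ℕ) := by exact_mod_cast hD1
    have hle1 : 1 / ((a * Nat.sqrt n : ℕ) : ℝ) ≤ 1 := (div_le_one (by linarith)).2 hD0
    have hbern := one_add_mul_le_pow (a := -(1 / ((a * Nat.sqrt n : ℕ) : ℝ))) (by linarith)
      (Nat.sqrt n)
    calc 1 - ε ≤ 1 - 1 / (a : ℝ) := one_sub_le_one_sub_inv_ceil h0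
      _ = 1 + (Nat.sqrt n : ℝ) * -(1 / ((a * Nat.sqrt n : ℕ) : ℝ)) := by
          push_cast
          field_simp
          ring
      _ ≤ _ := by rw [sub_eq_add_neg]; exact hbern

end AsymStream

theorem mainTheorem4 :
    (∃ P : AsymStream.Program, AsymStream.ApproximatesLCS P
      (fun n ε => (1 - ε) ^ Real.sqrt n)
      (fun n ε => Real.sqrt n + Real.logb (1 + ε) n)) ∧
    (∃ P : AsymStream.Program, AsymStream.ApproximatesLCS P
      (fun _ ε => 1 - ε)
      (fun n ε => Real.sqrt n / ε)) :=
  ⟨⟨_, AsymStream.approximates_pow⟩, ⟨_, AsymStream.approximates_one_sub⟩⟩
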